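/- **Circuits.** An \emph{extended arithmetic circuit} with $n$ inputs, $\ell$ auxiliary memory gates and $m$ outputs is a finite simple directed acyclic graph of gates: $n$ ordered input gates and $\ell$ ordered auxiliary memory gates (indegree $0$; together the \emph{memory gates}), $m$ ordered output gates (indegree $1$, outdegree $0$, copying their predecessor), constant gates labelled by reals (indegree $0$), addition and multiplication gates of unbounded fan-in, and possibly gates labelled by a function $f\colon\mathbb R\to\mathbb R$ from a given set $\mathcal B$ (indegree and outdegree $1$). Gates are evaluated along the graph in the obvious way. The size is the number of gates; the depth is the maximal length of a directed path between any two gates. For $\ell=0$ we speak of an \emph{arithmetic circuit}, whose depth is the maximal length of a directed path from an input gate to an output gate. A family $(C_n)_{n\in\mathbb N}$, where $C_n$ has $n$ inputs, is an $\mathrm{FAC}^i_{\mathbb R}[\mathcal B]$-family if it uses only functions from $\mathcal B$ as additional gates, has size $O(n^{O(1)})$ and depth $O((\log n)^i)$; $\mathrm{FAC}^i_{\mathbb R}[\mathcal B]$ is also the class of functions $\mathbb R^*\to\mathbb R^*$ computed by such families of arithmetic circuits. For $\mathfrak F=\mathrm{FAC}^i_{\mathbb R}[\mathcal B]$ put $\mathfrak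 F[\mathcal A]=\mathrm{FAC}^i_{\mathbb R}[\mathcal B\cup\mathcal A]$ and $\mathfrak F_s=\mathfrak F[\{\mathrm{sign}\}]$, where $\mathrm{sign}(x)=1$ if $x>0$ and $0$ otherwise. **Recurrent circuits.** A \emph{recurrent arithmetic circuit} with $n$ inputs consists of an extended arithmetic circuit $C$ with $n$ inputs, initial values for its auxiliary memory gates, exactly one recurrent edge into each memory gate (from a gate that is not an output gate), an ordered set of $p$ distinct halting gates, and a halting function $f_{\mathrm{halt}}\colon\mathbb N_{>0}\times\mathbb R^p\to\{0,1\}$. In iterations $k=1,2,\dots$ the circuit $C$ is evaluated on the current values of the memory gates (at first the input and the initial values). If $f_{\mathrm{halt}}$, applied to $k$ and the values of the halting gates, is $1$, the result is the tuple of values of the output gates; otherwise each memory gate takes the value of the source of its recurrent edge and iteration $k+1$ follows. If this never stops, the computed function is undefined. A family $(\textit{rec-}C_n)_n$, where $\textit{rec-}C_n$ has $n$ inputs, computes a partial function $\mathbb R^*\rightharpoonup\mathbb R^*$. It belongs to $\mathrm{rec}[\mathfrak F_s]\text{-}\mathfrak F[\mathcal A]$ if the underlying extended circuits form an $\mathfrak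 F[\mathcal A]$-family and there is one $\mathfrak F_s$-family $(D_k)_k$ of arithmetic circuits such that, for every $n$, the halting function of $\textit{rec-}C_n$ is $(k,\overline v)\mapsto f_{D_{p+1}}(k,\overline v)$, where $p$ is the number of halting gates of $\textit{rec-}C_n$. **Networks.** A labelled graph $\mathfrak G=(V,E,g_V)$ is a finite simple undirected graph with ordered vertex set and feature values $g_V\colon V\to\mathbb R$; its encoding $\langle\mathfrak G\rangle\in\mathbb R^{|V|^2+|V|}$ is its adjacency matrix, row by row, followed by the feature values in the order of $V$. A function on $\mathbb R^*$ is tail-symmetric if it is invariant under permutations of all arguments but the first; $t\mathfrak F$ denotes the tail-symmetric functions in $\mathfrak F$. A $\mathrm{rec}[t\mathfrak F_s]\text{-}(t\mathfrak F,\mathcal A)$-GNN $\textit{rec-}\mathcal N$ (a C-GNN with outer recurrence) consists of a periodic assignment $k\mapsto(f^{(k)},\sigma^{(k)})$ of real-valued functions $f^{(k)}\in t\mathfrak F$ and activation functions $\sigma^{(k)}\in\mathcal A$, where $\mathcal A$ is a set of functions $\mathbb R\to\mathbb R$, and a tail-symmetric halting function $h\colon\mathbb N_{>0}\times\mathbb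 R^*\to\{0,1\}$ computed by an $\mathfrak F_s$-family of arithmetic circuits. On $\mathfrak G$ it computes $h_V^{(0)}=g_V$ and $$h_V^{(k)}(w)=\sigma^{(k)}\Bigl(f^{(k)}\bigl(h_V^{(k-1)}(w),\{\!\!\{h_V^{(k-1)}(u)\mid \{u,w\}\in E\}\!\!\}\bigr)\Bigr)\qquad(k\ge 1),$$ and $f_{\textit{rec-}\mathcal N}(\mathfrak G)=(V,E,h_V^{(\ell)})$ for the least $\ell\ge 1$ with $h(\ell,\{\!\!\{h_V^{(\ell)}(v)\mid v\in V\}\!\!\})=1$; it is undefined if there is no such $\ell$. **Theorem.** Let $\mathfrak F=\mathrm{FAC}^i_{\mathbb R}[\mathcal B]$ with $i\in\mathbb N$ and $\mathcal B$ a set of functions $\mathbb R\to\mathbb R$, let $\mathcal A$ be a set of functions $\mathbb R\to\mathbb R$, and let $\textit{rec-}\mathcal N$ be a $\mathrm{rec}[t\mathfrak F_s]\text{-}(t\mathfrak F,\mathcal A)$-GNN. Then there is a partial function $f_{\mathrm{circ}}\in\mathrm{rec}[\mathfrak F_s]\text{-}\mathfrak F[\mathcal A]$ such that for all labelled graphs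 $\mathfrak G$ $$f_{\mathrm{circ}}(\langle\mathfrak G\rangle)=\langle f_{\textit{rec-}\mathcal N}(\mathfrak G)\rangle,$$ where the left side is defined if and only if the right side is. (Thus the underlying circuits need no sign gates beyond those that $\mathcal B\cup\mathcal A$ may already provide.) -/

import Mathlib

open Filter Asymptotics

noncomputable section

/-! ## Arithmetic circuits over the reals -/

/-- Gates of a circuit with `n` input gates, `l` auxiliary memory gates, `m` output gates and
a further set `I` of inner gates. -/
inductive Gate (n l m : ℕ) (I : Type) : Type
  | inp (j : Fin n)
  | aux (j : Fin l)
  | out (j : Fin m)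
  | inner (g : I)

/-- The gates as a disjoint union. -/
def Gate.equivSum (n l m : ℕ) (I : Type) :
    Gate n l m I ≃ (Fin n ⊕ Fin l) ⊕ (Fin m ⊕ I) where
  toFun
    | .inp j => .inl (.inl j)
    | .aux j => .inl (.inr j)
    | .out j => .inr (.inl j)
    | .inner g => .inr (.inr g)
  invFun
    | .inl (.inl j) => .inp j
    | .inl (.inr j) => .aux j
    | .inr (.inl j) => .out j
    | .inr (.inr g) => .inner g
  left_inv g := by cases g <;> rfl
  right_inv g := by rcases g with (g | g) | (g | g) <;> rfl

instance (n l m : ℕ) (I : Type) [Fintype I] : Fintype (Gate n l m I) :=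
  Fintype.ofEquiv _ (Gate.equivSum n l m I).symm

/-- Labels of the inner gates: a real constant, addition, multiplication, or a unary function
`f : ℝ → ℝ` used as an additional gate type. -/
inductive GateOp : Type
  | const (c : ℝ)
  | add
  | mul
  | fn (f : ℝ → ℝ)

/-- An extended arithmetic circuit with `n` inputs, `l` auxiliary memory gates and `m` outputs:
a finite simple directed acyclic graph, given by the finite set of predecessors of each gate.
Addition and multiplication gates have unbounded fan-in. -/
structure ExtCircuit (n l m : ℕ) where
  Inner : Type
  fintypeInner : Fintype Inner
  op : Inner → GateOp
  pred : Gate n l m Inner → Finset (Gate n l m Inner)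
  acyclic : ∀ g, ¬ Relation.TransGen (fun a b => a ∈ pred b) g g
  pred_inp : ∀ j, pred (.inp j) = ∅
  pred_aux : ∀ j, pred (.aux j) = ∅
  pred_out : ∀ j, (pred (.out j)).card = 1
  out_notMem_pred : ∀ j g, Gate.out j ∉ pred g
  pred_const : ∀ g c, op g = .const c → pred (.inner g) = ∅
  pred_fn : ∀ g f, op g = .fn f → (pred (.inner g)).card = 1
  succ_fn : ∀ g f, op g = .fn f → ∃! h, Gate.inner g ∈ pred h

namespace ExtCircuit

variable {n l m : ℕ} (C : ExtCircuit n l m)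

instance : Fintype C.Inner := C.fintypeInner

/-- The gates of the circuit. -/
abbrev Gates : Type := Gate n l m C.Inner

/-- `C.Edge g h`: there is an edge from `g` to `h`. -/
def Edge (g h : C.Gates) : Prop := g ∈ C.pred h

theorem wellFounded_edge : WellFounded C.Edge := by
  have hT : WellFounded (Relation.TransGen C.Edge) := by
    have : Std.Irrefl (Relation.TransGen C.Edge) := ⟨C.acyclic⟩
    exact Finite.wellFounded_of_trans_of_irrefl _
  exact Subrelation.wf (fun h => Relation.TransGen.single h) hT

/-- The value that a gate takes on input `x` and auxiliary memory values `a`.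
Output gates and function gates have exactly one predecessor, so the sums in these two cases
are the value of that predecessor. -/
def val (x : Fin n → ℝ) (a : Fin l → ℝ) : C.Gates → ℝ :=
  C.wellFounded_edge.fix fun g rec =>
    match g, rec with
    | .inp j, _ => x j
    | .aux j, _ => a j
    | .out j, rec => ∑ p : {p // p ∈ C.pred (.out j)}, rec p.1 p.2
    | .inner g, rec =>
      match C.op g with
      | .const c => c
      | .add => ∑ p : {p // p ∈ C.pred (.inner g)}, rec p.1 p.2
      | .mul => ∏ p : {p // p ∈ C.pred (.inner g)}, rec p.1 p.2
      | .fn f => f (∑ p : {p // p ∈ C.pred (.inner g)}, rec p.1 p.2)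

/-- The function `ℝⁿ × ℝˡ → ℝᵐ` computed by the circuit. -/
def eval (x : Fin n → ℝ) (a : Fin l → ℝ) : Fin m → ℝ := fun j => C.val x a (.out j)

/-- The number of gates. -/
def size : ℕ := Fintype.card C.Gates

/-- `C.Path g h k`: there is a directed path of length `k` from `g` to `h`. -/
inductive Path : C.Gates → C.Gates → ℕ → Prop
  | nil (g : C.Gates) : Path g g 0
  | snoc {g h h' : C.Gates} {k : ℕ} : Path g h k → C.Edge h h' → Path g h' (k + 1)

/-- Depth of an extended circuit: the maximal length of a directed path between any two gates. -/
def depth : ℕ := sSup {k | ∃ g h, C.Path g h k}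

/-- Depth of a non-extended circuit: the maximal length of a directed path from an input gate to
an output gate. -/
def ioDepth : ℕ := sSup {k | ∃ i j, C.Path (.inp i) (.out j) k}

/-- All function gates of the circuit are labelled with functions from `B`. -/
def UsesOnly (B : Set (ℝ → ℝ)) : Prop := ∀ g f, C.op g = .fn f → f ∈ B

end ExtCircuit

/-- A (non-extended) arithmetic circuit: no auxiliary memory gates. -/
abbrev ArithCircuit (n m : ℕ) : Type 1 := ExtCircuit n 0 m

/-! ## Circuit families and the classes `FAC^i[B]` -/

/-- `s(n) = O(n^{O(1)})`. -/
def PolyBounded (s : ℕ → ℕ) : Prop :=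
  ∃ k : ℕ, (fun n => (s n : ℝ)) =O[atTop] fun n : ℕ => (n : ℝ) ^ k

/-- `d(n) = O((log n)^i)`. -/
def PolylogBounded (i : ℕ) (d : ℕ → ℕ) : Prop :=
  (fun n => (d n : ℝ)) =O[atTop] fun n : ℕ => Real.log n ^ i

/-- A family of (non-extended) arithmetic circuits, one for each input length. -/
structure CircuitFamily where
  numOut : ℕ → ℕ
  circuit : ∀ n, ArithCircuit n (numOut n)

namespace CircuitFamily

/-- The function `ℝ* → ℝ*` computed by the family. -/
def eval (C : CircuitFamily) (x : List ℝ) : List ℝ :=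
  List.ofFn ((C.circuit x.length).eval x.get Fin.elim0)

/-- `C` is an `FAC^i[B]`-circuit family. -/
def IsFAC (C : CircuitFamily) (i : ℕ) (B : Set (ℝ → ℝ)) : Prop :=
  (∀ n, (C.circuit n).UsesOnly B) ∧
  PolyBounded (fun n => (C.circuit n).size) ∧
  PolylogBounded i (fun n => (C.circuit n).ioDepth)

end CircuitFamily

/-- The circuit function class `FAC^i[B]` of functions `ℝ* → ℝ*`. -/
def FAC (i : ℕ) (B : Set (ℝ → ℝ)) : Set (List ℝ → List ℝ) :=
  {f | ∃ C : CircuitFamily, C.IsFAC i B ∧ C.eval = f}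

/-- The sign function: `1` on positive reals, `0` otherwise. -/
def signFn (x : ℝ) : ℝ := if 0 < x then 1 else 0

/-- Bits as real numbers. -/
def bitR (b : Bool) : ℝ := if b then 1 else 0

/-! ## Recurrent arithmetic circuits -/

/-- A recurrent arithmetic circuit with `n` inputs. `recInp j` and `recAux j` are the sources of
the unique recurrent edges into the `j`-th input gate and the `j`-th auxiliary memory gate; as
output gates have fan-out zero, they are no output gates. The halting gates are an ordered set. -/
structure RecCircuit (n : ℕ) where
  numAux : ℕ
  numOut : ℕ
  circuit : ExtCircuit n numAux numOut
  init : Fin numAux → ℝ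
  recInp : Fin n → circuit.Gates
  recAux : Fin numAux → circuit.Gates
  recInp_ne_out : ∀ j k, recInp j ≠ .out k
  recAux_ne_out : ∀ j k, recAux j ≠ .out k
  numHalt : ℕ
  haltGate : Fin numHalt ↪ circuit.Gates
  halt : ℕ+ → (Fin numHalt → ℝ) → Bool

namespace RecCircuit

variable {n : ℕ} (R : RecCircuit n)

/-- Values of the input gates and of the auxiliary memory gates. -/
abbrev State : Type := (Fin n → ℝ) × (Fin R.numAux → ℝ)

/-- The memory gates take the values of the sources of their recurrent edges. -/
def step (s : R.State) : R.State :=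
  (fun j => R.circuit.val s.1 s.2 (R.recInp j), fun j => R.circuit.val s.1 s.2 (R.recAux j))

/-- Memory values during iteration `k + 1`. -/
def state (x : Fin n → ℝ) (k : ℕ) : R.State := R.step^[k] (x, R.init)

/-- The halting function evaluates to `1` in iteration `k + 1`. -/
def HaltsAt (x : Fin n → ℝ) (k : ℕ) : Prop :=
  R.halt k.succPNat
    (fun j => R.circuit.val (R.state x k).1 (R.state x k).2 (R.haltGate j)) = true

open Classical in
/-- The partial function computed by a recurrent circuit: the output of the first iteration in
which the halting function evaluates to `1`, undefined if there is none. -/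
def eval (x : Fin n → ℝ) : Part (Fin R.numOut → ℝ) where
  Dom := ∃ k, R.HaltsAt x k
  get h := R.circuit.eval (R.state x (Nat.find h)).1 (R.state x (Nat.find h)).2

end RecCircuit

/-- A recurrent arithmetic circuit family. -/
abbrev RecCircuitFamily : Type 1 := ∀ n, RecCircuit n

namespace RecCircuitFamily

/-- The partial function `ℝ* → ℝ*` computed by the family. -/
def eval (R : RecCircuitFamily) : List ℝ →. List ℝ := fun x =>
  ((R x.length).eval x.get).map List.ofFn

/-- The underlying extended circuits form an `FAC^i[B]`-family. -/
def UnderlyingFAC (R : RecCircuitFamily) (i : ℕ) (B : Set (ℝ → ℝ)) : Prop :=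
  (∀ n, (R n).circuit.UsesOnly B) ∧
  PolyBounded (fun n => (R n).circuit.size) ∧
  PolylogBounded i (fun n => (R n).circuit.depth)

/-- All halting functions belong to one `FAC^i[B]`-circuit family: the halting function of a
circuit with `p` halting gates is the function computed by the member with `p + 1` inputs, the
first of which is the iteration number. -/
def HaltingFAC (R : RecCircuitFamily) (i : ℕ) (B : Set (ℝ → ℝ)) : Prop :=
  ∃ D : CircuitFamily, D.IsFAC i B ∧ ∀ (n : ℕ) (k : ℕ+) (v : Fin (R n).numHalt → ℝ),
    D.eval (((k : ℕ) : ℝ) :: List.ofFn v) = [bitR ((R n).halt k v)]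

end RecCircuitFamily

/-- The recurrent circuit function class `rec[FAC^j[B']]-FAC^i[B]`. -/
def RecFAC (j : ℕ) (B' : Set (ℝ → ℝ)) (i : ℕ) (B : Set (ℝ → ℝ)) : Set (List ℝ →. List ℝ) :=
  {f | ∃ R : RecCircuitFamily, R.UnderlyingFAC i B ∧ R.HaltingFAC j B' ∧ R.eval = f}

/-! ## Labelled graphs -/

/-- A finite undirected graph with ordered vertex set and real feature values. -/
structure LabelledGraph where
  numV : ℕ
  graph : SimpleGraph (Fin numV)
  feature : Fin numV → ℝ

namespace LabelledGraph

open Classical in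
/-- The neighbours of `w`, listed in the order of the vertices. -/
def nbrs (G : LabelledGraph) (w : Fin G.numV) : List (Fin G.numV) :=
  (List.finRange G.numV).filter fun u => G.graph.Adj w u

open Classical in
/-- The adjacency matrix, row by row, followed by the feature values. -/
def encode (G : LabelledGraph) : List ℝ :=
  ((List.finRange G.numV).flatMap fun u =>
    (List.finRange G.numV).map fun v => G.graph.adjMatrix ℝ u v) ++ List.ofFn G.feature

end LabelledGraph

/-! ## Recurrent circuit graph neural networks -/

/-- `f(v₁, v₂, …, v_k)` is invariant under permutations of `v₂, …, v_k`, for every `k`. -/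
def TailSymmetric (f : List ℝ → ℝ) : Prop :=
  ∀ (x : ℝ) (l l' : List ℝ), l.Perm l' → f (x :: l) = f (x :: l')

/-- The real-valued tail-symmetric functions in `FAC^i[B]`. -/
def tFAC (i : ℕ) (B : Set (ℝ → ℝ)) : Set (List ℝ → ℝ) :=
  {f | TailSymmetric f ∧ (fun x => [f x]) ∈ FAC i B}

/-- The tail-symmetric halting functions `ℕ_{>0} × ℝ* → {0,1}` computed by
`FAC^i[B]`-circuit families. -/
def tFACHalt (i : ℕ) (B : Set (ℝ → ℝ)) : Set (ℕ+ → List ℝ → Bool) :=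
  {h | (∀ (k : ℕ+) (l l' : List ℝ), l.Perm l' → h k l = h k l') ∧
    ∃ D : CircuitFamily, D.IsFAC i B ∧ ∀ (k : ℕ+) (v : List ℝ),
      D.eval (((k : ℕ) : ℝ) :: v) = [bitR (h k v)]}

/-- A recurrent circuit graph neural network: layer functions, activation functions, and a
halting function. Layers are numbered from `1`. -/
structure RecCGNN where
  fn : ℕ → List ℝ → ℝ
  act : ℕ → ℝ → ℝ
  halt : ℕ+ → List ℝ → Bool

namespace RecCGNN

/-- `N` is a `rec[H]-(S, A)`-GNN: layers are assigned periodically, the layer functions are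
from `S`, the activation functions from `A`, and the halting function from `H`. -/
structure IsGNN (N : RecCGNN) (H : Set (ℕ+ → List ℝ → Bool)) (S : Set (List ℝ → ℝ))
    (A : Set (ℝ → ℝ)) : Prop where
  periodic : ∃ d : ℕ, 0 < d ∧ Function.Periodic (fun k => (N.fn k, N.act k)) d
  fn_mem : ∀ k, N.fn k ∈ S
  act_mem : ∀ k, N.act k ∈ A
  halt_mem : N.halt ∈ H

variable (N : RecCGNN) (G : LabelledGraph)

/-- The feature values after layer `k`. For tail-symmetric layer functions the order in which
the neighbours are listed is irrelevant. -/
def feat : ℕ → Fin G.numV → ℝ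
  | 0 => G.feature
  | k + 1 => fun w => N.act (k + 1) (N.fn (k + 1) (feat k w :: (G.nbrs w).map (feat k)))

/-- The halting function evaluates to `1` after layer `k + 1`. -/
def HaltsAt (k : ℕ) : Prop := N.halt k.succPNat (List.ofFn (N.feat G (k + 1))) = true

open Classical in
/-- The partial function on labelled graphs computed by the network: the feature values after the
first layer at which the halting function evaluates to `1`, undefined if there is none. -/
def eval : Part LabelledGraph where
  Dom := ∃ k, N.HaltsAt G k
  get h := { G with feature := N.feat G (Nat.find h + 1) }

end RecCGNN

end

/-! For a fixed number `n` of vertices, a single circuit, independent of the edges, computes one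
layer of the network. It has to find the neighbours of a vertex `w` without comparisons. The number
of neighbours of `w` before a vertex `u` is a sum of adjacency entries with a value in `{0, …, n}`,
so the indicator of each possible value is a Lagrange polynomial in it (`val_ind`). Multiplying by
the adjacency entry and the feature of `u` and summing over `u` yields the feature of the `j`-th
neighbour (`val_sel_encodeVec`). The degree of `w` is treated alike: circuits for all degrees `t <
n` run in parallel and the indicator of the true degree keeps one result (`val_fval`). This adds
only constant depth and polynomial size.

The recurrence is driven by `d` auxiliary gates, `d` being the period, which hold the current layer
in one-hot form and are rotated cyclically. Every iteration evaluates all `d` layers and selects one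
by the one-hot vector. Adjacency entries are fed back unchanged and features are replaced by the new
ones (`Realizes.state_eq`). The gates for the new features are also the halting gates, so the
circuit family of the network's halting function is reused as it is (`Realizes.recNet_eval`).

One mismatch has to be repaired: the depth of the layer circuits counts only paths from inputs to
outputs, whereas the depth of an extended circuit counts all paths. Gates on no input-output path
are therefore first replaced by constants (`exists_ranked`). Depth is then controlled by rank
functions, which combine easily when circuits are plugged together. -/

namespace ExtCircuit

variable {n l m : ℕ} (C : ExtCircuit n l m)

/-! ### Recursion equations for gate values -/

theorem val_inp (x : Fin n → ℝ) (a : Fin l → ℝ) (j : Fin n) : C.val x a (.inp j) = x j :=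
  C.wellFounded_edge.fix_eq _ _

theorem val_aux (x : Fin n → ℝ) (a : Fin l → ℝ) (j : Fin l) : C.val x a (.aux j) = a j :=
  C.wellFounded_edge.fix_eq _ _

theorem val_out (x : Fin n → ℝ) (a : Fin l → ℝ) (j : Fin m) :
    C.val x a (.out j) = ∑ p ∈ C.pred (.out j), C.val x a p := by
  rw [← Finset.sum_coe_sort]
  exact C.wellFounded_edge.fix_eq _ _

/-- The value of an inner gate in terms of the values of its predecessors. -/
theorem val_inner (x : Fin n → ℝ) (a : Fin l → ℝ) (g : C.Inner) :
    C.val x a (.inner g) =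
      match C.op g with
      | .const c => c
      | .add => ∑ p ∈ C.pred (.inner g), C.val x a p
      | .mul => ∏ p ∈ C.pred (.inner g), C.val x a p
      | .fn f => f (∑ p ∈ C.pred (.inner g), C.val x a p) := by
  rw [← Finset.sum_coe_sort, ← Finset.prod_coe_sort]
  exact C.wellFounded_edge.fix_eq _ _

theorem val_of_const {g : C.Inner} {c : ℝ} (h : C.op g = .const c) (x : Fin n → ℝ)
    (a : Fin l → ℝ) : C.val x a (.inner g) = c := by
  rw [val_inner, h]

theorem val_of_add {g : C.Inner} (h : C.op g = .add) (x : Fin n → ℝ) (a : Fin l → ℝ) :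
    C.val x a (.inner g) = ∑ p ∈ C.pred (.inner g), C.val x a p := by
  rw [val_inner, h]

theorem val_of_mul {g : C.Inner} (h : C.op g = .mul) (x : Fin n → ℝ) (a : Fin l → ℝ) :
    C.val x a (.inner g) = ∏ p ∈ C.pred (.inner g), C.val x a p := by
  rw [val_inner, h]

theorem val_of_fn {g : C.Inner} {f : ℝ → ℝ} (h : C.op g = .fn f) (x : Fin n → ℝ)
    (a : Fin l → ℝ) :
    C.val x a (.inner g) = f (∑ p ∈ C.pred (.inner g), C.val x a p) := by
  rw [val_inner, h]

theorem size_eq : C.size = n + l + (m + Fintype.card C.Inner) := by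
  rw [size, Fintype.card_congr (Gate.equivSum n l m C.Inner)]
  simp

/-! ### Paths -/

variable {C}

theorem Path.trans {g h h' : C.Gates} {k k' : ℕ} (p : C.Path g h k) (q : C.Path h h' k') :
    C.Path g h' (k + k') := by
  induction q with
  | nil => exact p
  | snoc _ e ih => exact .snoc ih e

theorem exists_path {g h : C.Gates} (p : Relation.ReflTransGen C.Edge g h) :
    ∃ k, C.Path g h k := by
  induction p with
  | refl => exact ⟨0, .nil _⟩
  | tail _ e ih => exact ih.imp' _ fun _ p => .snoc p e

/-- A rank function that increases along edges bounds the length of paths. -/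
theorem Path.add_le {rk : C.Gates → ℕ} (hrk : ∀ g h, C.Edge g h → rk g < rk h)
    {g h : C.Gates} {k : ℕ} (p : C.Path g h k) : rk g + k ≤ rk h := by
  induction p with
  | nil => simp
  | snoc _ e ih => have := hrk _ _ e; omega

variable (C)

/-- The depth is bounded by the maximum of any rank function that increases along edges. -/
theorem depth_le {rk : C.Gates → ℕ} (hrk : ∀ g h, C.Edge g h → rk g < rk h) {K : ℕ}
    (hK : ∀ g, rk g ≤ K) : C.depth ≤ K := by
  apply csSup_le'
  rintro k ⟨g, h, p⟩
  have := p.add_le hrk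
  have := hK h
  omega

/-- The number of proper ancestors of a gate. -/
noncomputable def ancestorCount (g : C.Gates) : ℕ :=
  {p | Relation.TransGen C.Edge p g}.ncard

/-- Ancestors are inherited along an edge, and `g` is a new one, since by acyclicity it is not its
own ancestor. Every finite circuit thus has a rank function. -/
theorem ancestorCount_lt {g h : C.Gates} (e : C.Edge g h) :
    C.ancestorCount g < C.ancestorCount h := by
  apply Set.ncard_lt_ncard _ (Set.toFinite _)
  exact ⟨fun p hp => Relation.TransGen.tail hp e, fun h => C.acyclic g (h (.single e))⟩

/-- A crude bound, needed so that the suprema defining `ioDepth` and `inpRank` are genuine maxima;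
on an unbounded set `sSup` would be a default value. -/
theorem Path.le_card {g h : C.Gates} {k : ℕ} (p : C.Path g h k) : k ≤ Nat.card C.Gates := by
  have h1 := p.add_le fun _ _ e => C.ancestorCount_lt e
  have h2 : C.ancestorCount h ≤ Nat.card C.Gates := Set.ncard_le_card _
  omega

/-! ### Reachability from inputs and to outputs -/

/-- The gate lies on a directed path that starts in an input gate. -/
def FromInp (g : C.Gates) : Prop := ∃ j, Relation.ReflTransGen C.Edge (.inp j) g

/-- The gate lies on a directed path that ends in an output gate. -/
def ToOut (g : C.Gates) : Prop := ∃ j, Relation.ReflTransGen C.Edge g (.out j)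

/-- The maximal length of a path from an input gate to the given gate. -/
noncomputable def inpRank (g : C.Gates) : ℕ := sSup {k | ∃ j, C.Path (.inp j) g k}

theorem bddAbove_inpRank (g : C.Gates) : BddAbove {k | ∃ j, C.Path (.inp j) g k} :=
  ⟨Nat.card C.Gates, by rintro k ⟨j, p⟩; exact p.le_card⟩

variable {C}

theorem FromInp.edge {g h : C.Gates} (hg : C.FromInp g) (e : C.Edge g h) : C.FromInp h :=
  hg.imp fun _ p => p.tail e

theorem ToOut.edge {g h : C.Gates} (hh : C.ToOut h) (e : C.Edge g h) : C.ToOut g :=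
  hh.imp fun _ p => p.head e

theorem FromInp.inpRank_mem {g : C.Gates} (hg : C.FromInp g) :
    ∃ j, C.Path (.inp j) g (C.inpRank g) := by
  obtain ⟨j, p⟩ := hg
  obtain ⟨k, p⟩ := exists_path p
  exact Nat.sSup_mem (s := {k | ∃ j, C.Path (.inp j) g k}) ⟨k, j, p⟩ (C.bddAbove_inpRank g)

theorem FromInp.inpRank_lt {g h : C.Gates} (hg : C.FromInp g) (e : C.Edge g h) :
    C.inpRank g < C.inpRank h := by
  obtain ⟨j, p⟩ := hg.inpRank_mem
  exact le_csSup (C.bddAbove_inpRank h) ⟨j, p.snoc e⟩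

/-- A longest path into `g`, continued to an output, is an input-output path. Only for gates
reachable on both sides does `ioDepth` give any information. -/
theorem FromInp.inpRank_le {g : C.Gates} (hg : C.FromInp g) (ho : C.ToOut g) :
    C.inpRank g ≤ C.ioDepth := by
  obtain ⟨j, p⟩ := hg.inpRank_mem
  obtain ⟨j', q⟩ := ho
  obtain ⟨k, q⟩ := exists_path q
  refine (Nat.le_add_right _ k).trans (le_csSup ?_ ⟨j, j', p.trans q⟩)
  exact ⟨Nat.card C.Gates, by rintro k ⟨_, _, p⟩; exact p.le_card⟩

/-- Gates that are not reachable from the inputs have constant values. -/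
theorem val_eq_of_not_fromInp {g : C.Gates} (hg : ¬ C.FromInp g) (x x' : Fin n → ℝ)
    (a : Fin l → ℝ) : C.val x a g = C.val x' a g := by
  induction g using C.wellFounded_edge.induction with
  | _ g ih =>
    have hp : ∀ p ∈ C.pred g, C.val x a p = C.val x' a p := fun p hp =>
      ih p hp fun h => hg (h.edge hp)
    match g with
    | .inp j => exact absurd ⟨j, .refl⟩ hg
    | .aux j => rw [val_aux, val_aux]
    | .out j => rw [val_out, val_out, Finset.sum_congr rfl hp]
    | .inner g =>
      rw [val_inner, val_inner, Finset.sum_congr rfl hp, Finset.prod_congr rfl hp]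

/-! ### Pruning gates that lie on no input-output path -/

variable (C)

/-- The gate lies on a directed path from an input gate to an output gate. -/
def Live (g : C.Gates) : Prop := C.FromInp g ∧ C.ToOut g

variable {C}

/-- The unique successor of a live function gate is live. -/
theorem Live.of_edge_fn {g : C.Inner} {f : ℝ → ℝ} (hf : C.op g = .fn f)
    (hg : C.Live (.inner g)) {h : C.Gates} (e : C.Edge (.inner g) h) : C.Live h := by
  refine ⟨hg.1.edge e, ?_⟩
  obtain ⟨j, p⟩ := hg.2
  obtain hj | ⟨h', e', p⟩ := Relation.ReflTransGen.cases_head p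
  · cases hj
  · exact ⟨j, (C.succ_fn g f hf).unique e e' ▸ p⟩

open Classical in
/-- The circuit in which inner gates that are not live are replaced by constants. -/
noncomputable abbrev prune (C : ArithCircuit n m) : ArithCircuit n m where
  Inner := C.Inner
  fintypeInner := C.fintypeInner
  -- The input `0` is arbitrary: the value matters only for gates that reach an output, and such a
  -- gate, if not live, does not depend on the input.
  op g := if C.Live (.inner g) then C.op g else .const (C.val 0 Fin.elim0 (.inner g))
  pred
    | .inner g => if C.Live (.inner g) then C.pred (.inner g) else ∅
    | g => C.pred g
  acyclic g hg := by
    refine C.acyclic g (Relation.TransGen.mono (fun a b hab => ?_) _ _ hg)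
    cases b with
    | inner b => by_cases hb : C.Live (.inner b) <;> simp_all
    | _ => exact hab
  pred_inp := C.pred_inp
  pred_aux := C.pred_aux
  pred_out := C.pred_out
  out_notMem_pred j g hg := by
    refine C.out_notMem_pred j g ?_
    cases g with
    | inner b => by_cases hb : C.Live (.inner b) <;> simp_all
    | _ => exact hg
  pred_const g c h := by
    by_cases hb : C.Live (.inner g)
    · simp only [hb, if_true] at h ⊢
      exact C.pred_const g c h
    · simp [hb]
  pred_fn g f h := by
    by_cases hb : C.Live (.inner g)
    · simp only [hb, if_true] at h ⊢
      exact C.pred_fn g f h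
    · simp [hb] at h
  succ_fn g f h := by
    by_cases hb : C.Live (.inner g)
    · simp only [hb, if_true] at h
      -- A function gate must keep its successor. The successor of a live function gate is live,
      -- hence retains its predecessors.
      obtain ⟨s, hs, hu⟩ := C.succ_fn g f h
      have hl := hb.of_edge_fn h hs
      refine ⟨s, ?_, fun s' hs' => hu s' ?_⟩
      · cases s with
        | inner s => simpa [hl] using hs
        | _ => exact hs
      · cases s' with
        | inner b => by_cases hb : C.Live (.inner b) <;> simp_all
        | _ => exact hs'
    · simp [hb] at h

/-- The assumption `ToOut` passes to predecessors, so the induction meets only dead gates that are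
unreachable from the inputs, and these are constant. -/
theorem prune_val (C : ArithCircuit n m) (x : Fin n → ℝ) {g : C.Gates} (hg : C.ToOut g) :
    C.prune.val x Fin.elim0 g = C.val x Fin.elim0 g := by
  induction g using C.wellFounded_edge.induction with
  | _ g ih =>
    have hp : ∀ p ∈ C.pred g, C.prune.val x Fin.elim0 p = C.val x Fin.elim0 p := fun p hp =>
      ih p hp (hg.edge hp)
    match g with
    | .inp j => rw [val_inp, val_inp]
    | .aux j => exact j.elim0
    | .out j => rw [val_out, val_out]; exact Finset.sum_congr rfl hp
    | .inner g =>
      by_cases hl : C.Live (.inner g)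
      · have h1 : C.prune.op g = C.op g := if_pos hl
        have h2 : C.prune.pred (.inner g) = C.pred (.inner g) := if_pos hl
        rw [val_inner, val_inner, h1, h2, Finset.sum_congr rfl hp, Finset.prod_congr rfl hp]
      · have h1 : C.prune.op g = .const (C.val 0 Fin.elim0 (.inner g)) := if_neg hl
        rw [val_of_const _ h1]
        exact val_eq_of_not_fromInp (fun h => hl ⟨h, hg⟩) _ _ _

theorem prune_eval (C : ArithCircuit n m) (x : Fin n → ℝ) :
    C.prune.eval x Fin.elim0 = C.eval x Fin.elim0 :=
  funext fun j => C.prune_val x ⟨j, .refl⟩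

theorem UsesOnly.prune {C : ArithCircuit n m} {B : Set (ℝ → ℝ)} (h : C.UsesOnly B) :
    C.prune.UsesOnly B := by
  intro g f hf
  by_cases hl : C.Live (.inner g)
  · exact h g f ((if_pos hl : C.prune.op g = C.op g) ▸ hf)
  · have h1 : C.prune.op g = .const (C.val 0 Fin.elim0 (.inner g)) := if_neg hl
    cases h1.symm.trans hf

theorem prune_size (C : ArithCircuit n m) : C.prune.size = C.size := by
  rw [size_eq, size_eq]

open Classical in
/-- A rank function for the gates of the pruned circuit. -/
noncomputable def pruneRank (C : ArithCircuit n m) : C.prune.Gates → ℕ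
  | .inp _ => 0
  | .aux _ => 0
  | .out _ => C.ioDepth + 2
  | .inner g => if C.Live (.inner g) then C.inpRank (.inner g) + 1 else 0

theorem pruneRank_inner_le (C : ArithCircuit n m) (g : C.Inner) :
    C.pruneRank (.inner g) ≤ C.ioDepth + 1 := by
  by_cases hl : C.Live (.inner g)
  · simpa [pruneRank, hl] using hl.1.inpRank_le hl.2
  · simp [pruneRank, hl]

theorem pruneRank_le (C : ArithCircuit n m) (g : C.prune.Gates) :
    C.pruneRank g ≤ C.ioDepth + 2 := by
  cases g with
  | inner g => exact (C.pruneRank_inner_le g).trans (Nat.le_succ _)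
  | _ => simp [pruneRank]

/-- The shift by one in the rank of live gates leaves rank `0` for inputs and constants; outputs lie
above everything, whether or not they are reachable from an input. -/
theorem pruneRank_lt (C : ArithCircuit n m) (g h : C.prune.Gates) (e : C.prune.Edge g h) :
    C.pruneRank g < C.pruneRank h := by
  match h with
  | .inp j => rw [Edge, C.prune.pred_inp] at e; simp at e
  | .aux j => exact j.elim0
  | .out j =>
    cases g with
    | out j' => exact absurd e (C.out_notMem_pred j' (.out j))
    | inner g => exact Nat.lt_succ_of_le (C.pruneRank_inner_le g)
    | _ => simp [pruneRank]
  | .inner h =>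
    by_cases hl : C.Live (.inner h)
    · have e' : C.Edge g (.inner h) := by
        have h2 : C.prune.pred (.inner h) = C.pred (.inner h) := if_pos hl
        rwa [Edge, h2] at e
      cases g with
      | out j' => exact absurd e' (C.out_notMem_pred j' _)
      | inner g =>
        by_cases hg : C.Live (.inner g)
        · simpa [pruneRank, hl, hg] using hg.1.inpRank_lt e'
        · simp [pruneRank, hl, hg]
      | _ => simp [pruneRank, hl]
    · have h2 : C.prune.pred (.inner h) = ∅ := if_neg hl
      rw [Edge, h2] at e; simp at e

/-- Every arithmetic circuit can be transformed such that all paths, not only those between inputs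
and outputs, are bounded in terms of the depth. -/
theorem exists_ranked (C : ArithCircuit n m) {B : Set (ℝ → ℝ)} (hC : C.UsesOnly B) :
    ∃ C' : ArithCircuit n m, C'.UsesOnly B ∧ C'.size = C.size ∧
      (∀ x, C'.eval x Fin.elim0 = C.eval x Fin.elim0) ∧
      ∃ rk : C'.Gates → ℕ, (∀ g h, C'.Edge g h → rk g < rk h) ∧ ∀ g, rk g ≤ C.ioDepth + 2 :=
  ⟨C.prune, hC.prune, C.prune_size, C.prune_eval, C.pruneRank, C.pruneRank_lt, C.pruneRank_le⟩

end ExtCircuit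

/-! ## The circuit that simulates one layer of a network -/

/-- The data of a periodic network with period `d`, restricted to graphs with `n` vertices: for
each layer `r` and each degree `t`, a circuit for the layer function with `t` neighbours, together
with a rank function for its gates, and the activation function of layer `r`. -/
structure LayerData (n d : ℕ) where
  sub : Fin d → (t : Fin n) → ArithCircuit (t + 1) 1
  act : Fin d → ℝ → ℝ
  rk : ∀ r t, (sub r t).Gates → ℕ
  bound : ℕ
  rk_lt : ∀ r t g h, (sub r t).Edge g h → rk r t g < rk r t h
  rk_le : ∀ r t g, rk r t g ≤ bound
  maxSize : ℕ
  size_le : ∀ r t, (sub r t).size ≤ maxSize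

/-- Inner gates of the simulating circuit.
* `shift j` and `norm j` are constants used for interpolation;
* `cnt w u` counts the neighbours of `w` among the first `u` vertices;
* `ind w u j` is the indicator of `cnt w u = j`, computed by interpolation from the differences
  `diff w u j`;
* `sel w j` is the feature of the `j`-th neighbour of `w`, a sum of the gates `term w u j`;
* `sub r w t g` is a copy of the gate `g` of the circuit for layer `r` and degree `t`, applied to
  the vertex `w`;
* `part r w t` is the value of this circuit if the degree of `w` is `t`, and `0` otherwise;
* `fval r w` is the value of the layer function `r`, and `fact r w` that of the activation function;
* `gated r w` is this value if the current layer is `r`, and `0` otherwise;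
* `new w` is the new feature of `w`. -/
inductive NetGate {n d : ℕ} (L : LayerData n d) : Type
  | shift (j : Fin (n + 1))
  | norm (j : Fin (n + 1))
  | cnt (w : Fin n) (u : Fin (n + 1))
  | diff (w : Fin n) (u j : Fin (n + 1))
  | ind (w : Fin n) (u j : Fin (n + 1))
  | term (w u j : Fin n)
  | sel (w j : Fin n)
  | sub (r : Fin d) (w t : Fin n) (g : (L.sub r t).Gates)
  | part (r : Fin d) (w t : Fin n)
  | fval (r : Fin d) (w : Fin n)
  | fact (r : Fin d) (w : Fin n)
  | gated (r : Fin d) (w : Fin n)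
  | new (w : Fin n)

/-- The position of an entry of the adjacency matrix in the encoding of a graph. -/
def adjIdx {n : ℕ} (w u : Fin n) : Fin (n * n + n) := Fin.castAdd n (finProdFinEquiv (w, u))

/-- The position of a feature value in the encoding of a graph. -/
def featIdx {n : ℕ} (w : Fin n) : Fin (n * n + n) := Fin.natAdd (n * n) w

theorem adjIdx_injective {n : ℕ} (w : Fin n) : Function.Injective (adjIdx w) := by
  intro u v h
  simpa [adjIdx] using h

theorem adjIdx_ne_featIdx {n : ℕ} (w u v : Fin n) : adjIdx w u ≠ featIdx v := by
  intro h
  have h1 := congrArg Fin.val h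
  have h2 := (finProdFinEquiv (w, u)).isLt
  simp only [adjIdx, featIdx, Fin.val_castAdd, Fin.val_natAdd] at h1
  omega

namespace LayerData

variable {n d : ℕ} (L : LayerData n d)

/-- The gates of the simulating circuit. -/
abbrev NetGates : Type := Gate (n * n + n) d (n * n + n) (NetGate L)

/-- A copied gate, as a gate of the simulating circuit. -/
abbrev subGate (r : Fin d) (w t : Fin n) (g : (L.sub r t).Gates) : L.NetGates :=
  .inner (.sub r w t g)

/-- The labels of the inner gates. -/
noncomputable def netOp : NetGate L → GateOp
  | .shift j => .const (-(j : ℝ))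
  | .norm j => .const (∏ t ∈ Finset.univ.erase j, ((j : ℝ) - (t : ℝ))⁻¹)
  | .cnt _ _ => .add
  | .diff _ _ _ => .add
  | .ind _ _ _ => .mul
  | .term _ _ _ => .mul
  | .sel _ _ => .add
  | .sub r _ t (.inner g) => (L.sub r t).op g
  -- Copied input and output gates become additions with a single predecessor, that is, mere copying
  -- gates.
  | .sub _ _ _ _ => .add
  | .part _ _ _ => .mul
  | .fval _ _ => .add
  | .fact r _ => .fn (L.act r)
  | .gated _ _ => .mul
  | .new _ => .add

/-- The gate that provides the `j`-th argument of the copied circuit for vertex `w` and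
degree `t`. -/
def source (w t : Fin n) (j : Fin (t + 1)) : L.NetGates :=
  Fin.cases (.inp (featIdx w)) (fun j => .inner (.sel w (j.castLE t.isLt.le))) j

/-- The gate that provides the next value of the `j`-th input gate, which is also the value of
the `j`-th output gate. -/
def next (j : Fin (n * n + n)) : L.NetGates :=
  Fin.addCases (fun _ => .inp j) (fun w => .inner (.new w)) j

noncomputable instance : DecidableEq L.NetGates := Classical.decEq _

/-- The predecessors of the inner gates. -/
noncomputable def netPred : NetGate L → Finset L.NetGates
  | .shift _ => ∅
  | .norm _ => ∅
  | .cnt w u =>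
    (Finset.univ.filter fun v : Fin n => v.castSucc < u).image fun v => .inp (adjIdx w v)
  | .diff w u j => {.inner (.cnt w u), .inner (.shift j)}
  | .ind w u j =>
    insert (.inner (.norm j)) ((Finset.univ.erase j).image fun t => .inner (.diff w u t))
  | .term w u j =>
    {.inp (adjIdx w u), .inner (.ind w u.castSucc j.castSucc), .inp (featIdx u)}
  | .sel w j => Finset.univ.image fun u => .inner (.term w u j)
  | .sub _ w t (.inp j) => {L.source w t j}
  | .sub r w t g => ((L.sub r t).pred g).image (L.subGate r w t)
  | .part r w t =>
    {.inner (.ind w (Fin.last n) t.castSucc), L.subGate r w t (.out 0)}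
  | .fval r w => Finset.univ.image fun t => .inner (.part r w t)
  | .fact r w => {.inner (.fval r w)}
  | .gated r w => {.aux r, .inner (.fact r w)}
  | .new w => Finset.univ.image fun r => .inner (.gated r w)

/-- The predecessors of the gates. -/
noncomputable def gatePred : L.NetGates → Finset L.NetGates
  | .inp _ => ∅
  | .aux _ => ∅
  | .out j => {L.next j}
  | .inner g => L.netPred g

/-- A rank function for the inner gates. -/
def innerRank : NetGate L → ℕ
  | .shift _ => 0
  | .norm _ => 0
  | .cnt _ _ => 1
  | .diff _ _ _ => 2
  | .ind _ _ _ => 3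
  | .term _ _ _ => 4
  | .sel _ _ => 5
  | .sub r _ t g => L.rk r t g + 6
  | .part _ _ _ => L.bound + 7
  | .fval _ _ => L.bound + 8
  | .fact _ _ => L.bound + 9
  | .gated _ _ => L.bound + 10
  | .new _ => L.bound + 11

/-- A rank function for all gates. -/
def netRank : L.NetGates → ℕ
  | .inp _ => 0
  | .aux _ => 0
  | .out _ => L.bound + 12
  | .inner g => L.innerRank g

theorem innerRank_le (g : NetGate L) : L.innerRank g ≤ L.bound + 11 := by
  cases g with
  | sub r w t g => have := L.rk_le r t g; simp only [innerRank]; omega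
  | _ => simp only [innerRank]; omega

theorem netRank_le (g : L.NetGates) : L.netRank g ≤ L.bound + 12 := by
  cases g with
  | inner g => exact (L.innerRank_le g).trans (Nat.le_succ _)
  | _ => simp [netRank]

theorem netRank_source_lt (w t : Fin n) (j : Fin (t + 1)) : L.netRank (L.source w t j) < 6 := by
  cases j using Fin.cases <;> simp [source, netRank, innerRank]

theorem next_ne_out (j k : Fin (n * n + n)) : L.next j ≠ .out k := by
  cases j using Fin.addCases <;> simp [next]

theorem netRank_next_lt (j : Fin (n * n + n)) : L.netRank (L.next j) < L.bound + 12 := by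
  cases j using Fin.addCases <;> simp [next, netRank, innerRank]

theorem netPred_sub {r : Fin d} {w t : Fin n} {h : (L.sub r t).Gates} (hh : ∀ j, h ≠ .inp j) :
    L.netPred (.sub r w t h) = ((L.sub r t).pred h).image (L.subGate r w t) := by
  cases h with
  | inp j => exact absurd rfl (hh j)
  | _ => rfl

theorem netRank_lt (g h : L.NetGates) (e : g ∈ L.gatePred h) : L.netRank g < L.netRank h := by
  match h with
  | .inp _ => simp [gatePred] at e
  | .aux _ => simp [gatePred] at e
  | .out j =>
    simp only [gatePred, Finset.mem_singleton] at e
    exact e ▸ L.netRank_next_lt j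
  | .inner (.sub r w t h) =>
    by_cases hh : ∃ j, h = .inp j
    · obtain ⟨j, rfl⟩ := hh
      simp only [gatePred, netPred, Finset.mem_singleton] at e
      have := L.netRank_source_lt w t j
      rw [e]
      simp only [netRank, innerRank] at this ⊢
      omega
    · rw [gatePred, L.netPred_sub (not_exists.1 hh)] at e
      obtain ⟨p, hp, rfl⟩ := Finset.mem_image.1 e
      simpa [netRank, innerRank] using L.rk_lt r t p h hp
  | .inner (.shift _) => simp [gatePred, netPred] at e
  | .inner (.norm _) => simp [gatePred, netPred] at e
  | .inner (.cnt _ _) | .inner (.sel _ _) | .inner (.fval _ _) | .inner (.new _) =>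
    obtain ⟨v, _, rfl⟩ := Finset.mem_image.1 e
    simp [netRank, innerRank]
  | .inner (.ind _ _ _) =>
    obtain rfl | e := Finset.mem_insert.1 e
    · simp [netRank, innerRank]
    · obtain ⟨v, _, rfl⟩ := Finset.mem_image.1 e
      simp [netRank, innerRank]
  | .inner (.fact _ _) =>
    obtain rfl := Finset.mem_singleton.1 e
    simp [netRank, innerRank]
  | .inner (.diff _ _ _) | .inner (.gated _ _) =>
    simp only [gatePred, netPred, Finset.mem_insert, Finset.mem_singleton] at e
    obtain rfl | rfl := e <;> simp [netRank, innerRank]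
  | .inner (.term _ _ _) =>
    simp only [gatePred, netPred, Finset.mem_insert, Finset.mem_singleton] at e
    obtain rfl | rfl | rfl := e <;> simp [netRank, innerRank]
  | .inner (.part r w t) =>
    simp only [gatePred, netPred, Finset.mem_insert, Finset.mem_singleton] at e
    have := L.rk_le r t (.out 0)
    obtain rfl | rfl := e <;> simp only [netRank, innerRank] <;> omega

theorem subGate_injective (r : Fin d) (w t : Fin n) :
    Function.Injective (L.subGate r w t) := by
  intro g h e
  simpa [subGate] using e

theorem source_ne_sub (w t : Fin n) (j : Fin (t + 1)) (r' : Fin d) (w' t' : Fin n)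
    (g : (L.sub r' t').Gates) : L.source w t j ≠ .inner (.sub r' w' t' g) := by
  cases j using Fin.cases <;> simp [source]

theorem source_ne_fact (w t : Fin n) (j : Fin (t + 1)) (r' : Fin d) (w' : Fin n) :
    L.source w t j ≠ .inner (.fact r' w') := by
  cases j using Fin.cases <;> simp [source]

theorem source_ne_out (w t : Fin n) (j : Fin (t + 1)) (k : Fin (n * n + n)) :
    L.source w t j ≠ .out k := by
  cases j using Fin.cases <;> simp [source]

theorem next_ne_sub (j : Fin (n * n + n)) (r : Fin d) (w t : Fin n) (g : (L.sub r t).Gates) :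
    L.next j ≠ .inner (.sub r w t g) := by
  cases j using Fin.addCases <;> simp [next]

theorem next_ne_fact (j : Fin (n * n + n)) (r : Fin d) (w : Fin n) :
    L.next j ≠ .inner (.fact r w) := by
  cases j using Fin.addCases <;> simp [next]

theorem out_notMem_gatePred (k : Fin (n * n + n)) (h : L.NetGates) :
    .out k ∉ L.gatePred h := by
  match h with
  | .out j => simpa [gatePred] using (L.next_ne_out j k).symm
  | .inner (.sub r w t (.inp j)) =>
    simpa [gatePred, netPred] using (L.source_ne_out w t j k).symm
  | .inp _ | .aux _
  | .inner (.sub _ _ _ (.aux _)) | .inner (.sub _ _ _ (.out _)) | .inner (.sub _ _ _ (.inner _))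
  | .inner (.shift _) | .inner (.norm _) | .inner (.cnt _ _) | .inner (.diff _ _ _)
  | .inner (.ind _ _ _) | .inner (.term _ _ _) | .inner (.sel _ _) | .inner (.part _ _ _)
  | .inner (.fval _ _) | .inner (.fact _ _) | .inner (.gated _ _) | .inner (.new _) =>
    simp [gatePred, netPred]

/-- Activation gates are function gates and need outdegree one; for this reason there is one for
each pair of layer and vertex. -/
theorem eq_gated_of_fact_mem {r : Fin d} {w : Fin n} {h : L.NetGates}
    (e : .inner (.fact r w) ∈ L.gatePred h) : h = .inner (.gated r w) := by
  match h with
  | .out j => exact absurd (Finset.mem_singleton.1 e).symm (L.next_ne_fact j r w)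
  | .inner (.sub r' w' t' (.inp j)) =>
    exact absurd (Finset.mem_singleton.1 e).symm (L.source_ne_fact w' t' j r w)
  | .inner (.gated r' w') =>
    simpa [gatePred, netPred, eq_comm] using e
  | .inp _ | .aux _
  | .inner (.sub _ _ _ (.aux _)) | .inner (.sub _ _ _ (.out _)) | .inner (.sub _ _ _ (.inner _))
  | .inner (.shift _) | .inner (.norm _) | .inner (.cnt _ _) | .inner (.diff _ _ _)
  | .inner (.ind _ _ _) | .inner (.term _ _ _) | .inner (.sel _ _) | .inner (.part _ _ _)
  | .inner (.fval _ _) | .inner (.fact _ _) | .inner (.new _) =>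
    simp [gatePred, netPred] at e

/-- A copied circuit is left only through its output gate, so a copied function gate gains no
successors beyond the copy of its original one. -/
theorem exists_eq_subGate_of_mem {r : Fin d} {w t : Fin n} {g : (L.sub r t).Inner}
    {h : L.NetGates} (e : L.subGate r w t (.inner g) ∈ L.gatePred h) :
    ∃ h' : (L.sub r t).Gates, h = L.subGate r w t h' ∧ .inner g ∈ (L.sub r t).pred h' := by
  match h with
  | .out j => exact absurd (Finset.mem_singleton.1 e).symm (L.next_ne_sub j _ _ _ _)
  | .inner (.sub r' w' t' h) =>
    by_cases hh : ∃ j, h = .inp j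
    · obtain ⟨j, rfl⟩ := hh
      exact absurd (Finset.mem_singleton.1 e).symm (L.source_ne_sub w' t' j _ _ _ _)
    · rw [gatePred, L.netPred_sub (not_exists.1 hh)] at e
      obtain ⟨p, hp, hpe⟩ := Finset.mem_image.1 e
      cases hpe
      exact ⟨h, rfl, hp⟩
  | .inner (.part r' w' t') =>
    simp only [gatePred, netPred, Finset.mem_insert, Finset.mem_singleton] at e
    obtain e | e := e <;> cases e
  | .inp _ | .aux _
  | .inner (.shift _) | .inner (.norm _) | .inner (.cnt _ _) | .inner (.diff _ _ _)
  | .inner (.ind _ _ _) | .inner (.term _ _ _) | .inner (.sel _ _)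
  | .inner (.fval _ _) | .inner (.fact _ _) | .inner (.gated _ _) | .inner (.new _) =>
    simp [gatePred, netPred] at e

/-! ### Number of gates -/

/-- A numbering of the gates of a copied circuit. -/
noncomputable def subIdx (r : Fin d) (t : Fin n) (g : (L.sub r t).Gates) : Fin (L.maxSize + 1) :=
  (Fintype.equivFin _ g).castLE ((L.size_le r t).trans (Nat.le_succ _))

theorem subIdx_injective (r : Fin d) (t : Fin n) : Function.Injective (L.subIdx r t) := by
  intro g h e
  exact (Fintype.equivFin _).injective (Fin.castLE_injective _ e)

/-- An injective encoding of the inner gates that bounds their number. -/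
noncomputable def code : NetGate L →
    Fin 13 × Fin (d + 1) × (Fin (n + 1) × Fin (n + 1) × Fin (n + 1)) × Fin (L.maxSize + 1)
  | .shift j => (0, 0, (0, 0, j), 0)
  | .norm j => (1, 0, (0, 0, j), 0)
  | .cnt w u => (2, 0, (w.castSucc, u, 0), 0)
  | .diff w u j => (3, 0, (w.castSucc, u, j), 0)
  | .ind w u j => (4, 0, (w.castSucc, u, j), 0)
  | .term w u j => (5, 0, (w.castSucc, u.castSucc, j.castSucc), 0)
  | .sel w j => (6, 0, (w.castSucc, 0, j.castSucc), 0)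
  | .sub r w t g => (7, r.castSucc, (w.castSucc, t.castSucc, 0), L.subIdx r t g)
  | .part r w t => (8, r.castSucc, (w.castSucc, t.castSucc, 0), 0)
  | .fval r w => (9, r.castSucc, (w.castSucc, 0, 0), 0)
  | .fact r w => (10, r.castSucc, (w.castSucc, 0, 0), 0)
  | .gated r w => (11, r.castSucc, (w.castSucc, 0, 0), 0)
  | .new w => (12, 0, (w.castSucc, 0, 0), 0)

theorem code_injective : Function.Injective L.code := by
  intro g h e
  have h1 := congrArg Prod.fst e
  cases g <;> cases h <;> first
    | (simp [code] at h1; done)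
    | simpa [code] using e
    | skip
  rename_i r w t g r' w' t' g'
  simp only [code, Prod.mk.injEq, Fin.castSucc_inj, true_and, and_true] at e
  obtain ⟨rfl, ⟨rfl, rfl⟩, e⟩ := e
  rw [L.subIdx_injective r t e]

instance : Finite (NetGate L) := Finite.of_injective _ L.code_injective

noncomputable instance : Fintype (NetGate L) := Fintype.ofFinite _

theorem card_netGate_le :
    Fintype.card (NetGate L) ≤ 13 * ((d + 1) * ((n + 1) ^ 3 * (L.maxSize + 1))) := by
  refine (Fintype.card_le_of_injective _ L.code_injective).trans_eq ?_
  simp only [Fintype.card_prod, Fintype.card_fin]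
  ring

/-- The circuit that computes one layer of the network. -/
noncomputable abbrev net : ExtCircuit (n * n + n) d (n * n + n) where
  Inner := NetGate L
  fintypeInner := inferInstance
  op := L.netOp
  pred := L.gatePred
  acyclic g hg := by
    have h : ∀ a b, Relation.TransGen (fun a b => a ∈ L.gatePred b) a b →
        L.netRank a < L.netRank b := by
      intro a b hab
      induction hab with
      | single e => exact L.netRank_lt _ _ e
      | tail _ e ih => exact ih.trans (L.netRank_lt _ _ e)
    exact lt_irrefl _ (h g g hg)
  pred_inp _ := rfl
  pred_aux _ := rfl
  pred_out _ := by simp [gatePred]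
  out_notMem_pred := L.out_notMem_gatePred
  pred_const g c h := by
    match g with
    | .sub r w t (.inner g) =>
      simp only [netOp] at h
      simp [gatePred, netPred, (L.sub r t).pred_const g c h]
    | .shift _ | .norm _ => rfl
    | .sub _ _ _ (.inp _) | .sub _ _ _ (.aux _) | .sub _ _ _ (.out _)
    | .cnt _ _ | .diff _ _ _ | .ind _ _ _ | .term _ _ _ | .sel _ _
    | .part _ _ _ | .fval _ _ | .fact _ _ | .gated _ _ | .new _ =>
      simp [netOp] at h
  pred_fn g f h := by
    match g with
    | .sub r w t (.inner g) =>
      simp only [netOp] at h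
      rw [gatePred, L.netPred_sub (by simp),
        Finset.card_image_of_injective _ (L.subGate_injective r w t), (L.sub r t).pred_fn g f h]
    | .fact r w => simp [gatePred, netPred]
    | .shift _ | .norm _
    | .sub _ _ _ (.inp _) | .sub _ _ _ (.aux _) | .sub _ _ _ (.out _)
    | .cnt _ _ | .diff _ _ _ | .ind _ _ _ | .term _ _ _ | .sel _ _
    | .part _ _ _ | .fval _ _ | .gated _ _ | .new _ =>
      simp [netOp] at h
  succ_fn g f h := by
    match g with
    | .sub r w t (.inner g) =>
      simp only [netOp] at h
      obtain ⟨s, hs, hu⟩ := (L.sub r t).succ_fn g f h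
      refine ⟨L.subGate r w t s, ?_, fun s' hs' => ?_⟩
      -- Copied input gates are the only copies whose predecessors are not copied; they cannot occur
      -- here, as input gates have no predecessors in the original.
      · have hj : ∀ j, s ≠ .inp j := by
          rintro j rfl
          simp [(L.sub r t).pred_inp] at hs
        simp only [gatePred]
        rw [L.netPred_sub hj]
        exact Finset.mem_image_of_mem _ hs
      · obtain ⟨h', rfl, hh⟩ := L.exists_eq_subGate_of_mem hs'
        rw [hu h' hh]
    | .fact r w =>
      exact ⟨.inner (.gated r w), by simp [gatePred, netPred], fun s => L.eq_gated_of_fact_mem⟩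
    | .shift _ | .norm _
    | .sub _ _ _ (.inp _) | .sub _ _ _ (.aux _) | .sub _ _ _ (.out _)
    | .cnt _ _ | .diff _ _ _ | .ind _ _ _ | .term _ _ _ | .sel _ _
    | .part _ _ _ | .fval _ _ | .gated _ _ | .new _ =>
      simp [netOp] at h

theorem net_usesOnly {B A : Set (ℝ → ℝ)} (hB : ∀ r t, (L.sub r t).UsesOnly B)
    (hA : ∀ r, L.act r ∈ A) : L.net.UsesOnly (B ∪ A) := by
  intro g f h
  match g with
  | .sub r w t (.inner g) => exact .inl (hB r t g f h)
  | .fact r w =>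
    simp only [netOp, GateOp.fn.injEq] at h
    exact .inr (h ▸ hA r)
  | .shift _ | .norm _
  | .sub _ _ _ (.inp _) | .sub _ _ _ (.aux _) | .sub _ _ _ (.out _)
  | .cnt _ _ | .diff _ _ _ | .ind _ _ _ | .term _ _ _ | .sel _ _
  | .part _ _ _ | .fval _ _ | .gated _ _ | .new _ =>
    simp [netOp] at h

theorem net_depth_le : L.net.depth ≤ L.bound + 12 :=
  L.net.depth_le L.netRank_lt L.netRank_le

theorem net_size_le : L.net.size ≤ (n * n + n) + d + ((n * n + n) +
    13 * ((d + 1) * ((n + 1) ^ 3 * (L.maxSize + 1)))) := by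
  rw [ExtCircuit.size_eq]
  exact Nat.add_le_add_left (Nat.add_le_add_left L.card_netGate_le _) _

end LayerData

/-! ## Values of the gates of the simulating circuit -/

/-- Indicators of natural numbers up to `n` by interpolation. -/
theorem prod_erase_sub_mul_prod_inv {n : ℕ} (c j : Fin (n + 1)) :
    (∏ t ∈ Finset.univ.erase j, ((j : ℝ) - (t : ℝ))⁻¹) *
      ∏ t ∈ Finset.univ.erase j, ((c : ℝ) - (t : ℝ)) = if c = j then 1 else 0 := by
  rw [← Finset.prod_mul_distrib]
  split_ifs with h
  · subst h
    refine Finset.prod_eq_one fun t ht => inv_mul_cancel₀ (sub_ne_zero.2 fun h => ?_)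
    exact (Finset.mem_erase.1 ht).1 (Fin.ext (by exact_mod_cast h.symm))
  · exact Finset.prod_eq_zero (Finset.mem_erase.2 ⟨h, Finset.mem_univ c⟩) (by simp)

/-- The `j`-th element of a filtered list has exactly `j` predecessors satisfying the predicate. -/
theorem card_filter_lt_get_filter {n : ℕ} (p : Fin n → Bool)
    (j : Fin ((List.finRange n).filter p).length) :
    (Finset.univ.filter fun v : Fin n => v < ((List.finRange n).filter p).get j ∧ p v).card = j := by
  generalize hl : (List.finRange n).filter p = l at j ⊢
  have hmono : StrictMono l.get := by
    rw [← hl]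
    exact List.sortedLT_iff_strictMono_get.1 ((List.pairwise_lt_finRange n).filter p).sortedLT
  have h : (Finset.univ.filter fun v : Fin n => v < l.get j ∧ p v) =
      (Finset.Iio j).image l.get := by
    ext v
    simp only [Finset.mem_filter, Finset.mem_univ, true_and, Finset.mem_image, Finset.mem_Iio]
    constructor
    · rintro ⟨hv, hp⟩
      obtain ⟨k, rfl⟩ := List.mem_iff_get.1 (show v ∈ l by simp [← hl, hp])
      exact ⟨k, hmono.lt_iff_lt.1 hv, rfl⟩
    · rintro ⟨k, hk, rfl⟩
      exact ⟨hmono hk, (List.mem_filter.1 (by rw [hl]; exact l.get_mem k : l.get k ∈ _)).2⟩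
  rw [h, Finset.card_image_of_injective _ hmono.injective, Fin.card_Iio]

namespace LayerData

variable {n d : ℕ} (L : LayerData n d) (x : Fin (n * n + n) → ℝ) (a : Fin d → ℝ)

theorem val_cnt (w : Fin n) (u : Fin (n + 1)) :
    L.net.val x a (.inner (.cnt w u)) =
      ∑ v ∈ Finset.univ.filter fun v : Fin n => v.castSucc < u, x (adjIdx w v) := by
  rw [ExtCircuit.val_of_add _ rfl]
  simp only [gatePred, netPred]
  rw [Finset.sum_image fun v _ v' _ h => adjIdx_injective w (by simpa using h)]
  exact Finset.sum_congr rfl fun v _ => L.net.val_inp x a _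

theorem val_diff (w : Fin n) (u j : Fin (n + 1)) :
    L.net.val x a (.inner (.diff w u j)) = L.net.val x a (.inner (.cnt w u)) - (j : ℝ) := by
  rw [ExtCircuit.val_of_add _ rfl]
  simp only [gatePred, netPred]
  rw [Finset.sum_pair (by simp), L.net.val_of_const (g := NetGate.shift j) rfl,
    sub_eq_add_neg]

/-- Interpolation at the nodes `0, …, n`; it is an indicator only because the count is known to be
one of these nodes. -/
theorem val_ind (w : Fin n) (u j c : Fin (n + 1))
    (hc : L.net.val x a (.inner (.cnt w u)) = (c : ℝ)) :
    L.net.val x a (.inner (.ind w u j)) = if c = j then 1 else 0 := by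
  rw [ExtCircuit.val_of_mul _ rfl]
  simp only [gatePred, netPred]
  rw [Finset.prod_insert (by simp), Finset.prod_image (fun _ _ _ _ h => by simpa using h),
    L.net.val_of_const (g := NetGate.norm j) rfl, ← prod_erase_sub_mul_prod_inv]
  congr 1
  exact Finset.prod_congr rfl fun t _ => by rw [val_diff, hc]

theorem val_sel (w j : Fin n) :
    L.net.val x a (.inner (.sel w j)) =
      ∑ u, x (adjIdx w u) *
        (L.net.val x a (.inner (.ind w u.castSucc j.castSucc)) * x (featIdx u)) := by
  rw [ExtCircuit.val_of_add _ rfl]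
  simp only [gatePred, netPred]
  rw [Finset.sum_image fun _ _ _ _ h => by simpa using h]
  refine Finset.sum_congr rfl fun u _ => ?_
  rw [ExtCircuit.val_of_mul _ rfl]
  simp only [gatePred, netPred]
  rw [Finset.prod_insert (by simp [adjIdx_ne_featIdx]), Finset.prod_pair (by simp),
    ExtCircuit.val_inp, ExtCircuit.val_inp]

theorem val_sub (r : Fin d) (w t : Fin n) (g : (L.sub r t).Gates) :
    L.net.val x a (L.subGate r w t g) =
      (L.sub r t).val (fun j => L.net.val x a (L.source w t j)) Fin.elim0 g := by
  induction g using (L.sub r t).wellFounded_edge.induction with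
  | _ g ih =>
    have hs : ∑ p ∈ ((L.sub r t).pred g).image (L.subGate r w t), L.net.val x a p =
        ∑ p ∈ (L.sub r t).pred g,
          (L.sub r t).val (fun j => L.net.val x a (L.source w t j)) Fin.elim0 p := by
      rw [Finset.sum_image fun p _ q _ h => L.subGate_injective r w t h]
      exact Finset.sum_congr rfl ih
    have hm : ∏ p ∈ ((L.sub r t).pred g).image (L.subGate r w t), L.net.val x a p =
        ∏ p ∈ (L.sub r t).pred g,
          (L.sub r t).val (fun j => L.net.val x a (L.source w t j)) Fin.elim0 p := by
      rw [Finset.prod_image fun p _ q _ h => L.subGate_injective r w t h]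
      exact Finset.prod_congr rfl ih
    match g with
    | .inp j =>
      rw [ExtCircuit.val_of_add _ rfl, ExtCircuit.val_inp]
      simp only [gatePred, netPred, Finset.sum_singleton]
    | .aux j => exact j.elim0
    | .out j =>
      rw [ExtCircuit.val_of_add _ rfl, ExtCircuit.val_out, ← hs]
      simp only [gatePred]
      rw [L.netPred_sub (by simp)]
    | .inner g =>
      have hp : L.net.pred (L.subGate r w t (.inner g)) =
          ((L.sub r t).pred (.inner g)).image (L.subGate r w t) :=
        L.netPred_sub (h := .inner g) (by simp)
      have ho : L.net.op (.sub r w t (.inner g)) = (L.sub r t).op g := rfl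
      rw [ExtCircuit.val_inner, ExtCircuit.val_inner, ho, hp, hs, hm]

/-- Circuits for wrong degrees receive meaningless arguments, but their results are multiplied by
`0`. -/
theorem val_fval (r : Fin d) (w : Fin n) (c : Fin n)
    (hc : L.net.val x a (.inner (.cnt w (Fin.last n))) = (c : ℝ)) :
    L.net.val x a (.inner (.fval r w)) =
      (L.sub r c).eval (fun j => L.net.val x a (L.source w c j)) Fin.elim0 0 := by
  rw [ExtCircuit.val_of_add _ rfl]
  simp only [gatePred, netPred]
  rw [Finset.sum_image fun _ _ _ _ h => by simpa using h]
  have h : ∀ t, L.net.val x a (.inner (.part r w t)) = if c = t then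
      (L.sub r t).eval (fun j => L.net.val x a (L.source w t j)) Fin.elim0 0 else 0 := by
    intro t
    rw [ExtCircuit.val_of_mul _ rfl]
    simp only [gatePred, netPred]
    rw [Finset.prod_pair (by simp), val_ind _ _ _ _ _ _ c.castSucc (by simpa using hc), val_sub]
    simp [ExtCircuit.eval]
  simp only [h, Finset.sum_ite_eq, Finset.mem_univ, if_true]

/-- The selection of the layer happens after the activation, since an activation function need not
fix `0`. -/
theorem val_new (w : Fin n) :
    L.net.val x a (.inner (.new w)) =
      ∑ r, a r * L.act r (L.net.val x a (.inner (.fval r w))) := by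
  rw [ExtCircuit.val_of_add _ rfl]
  simp only [gatePred, netPred]
  rw [Finset.sum_image fun _ _ _ _ h => by simpa using h]
  refine Finset.sum_congr rfl fun r _ => ?_
  rw [ExtCircuit.val_of_mul _ rfl]
  simp only [gatePred, netPred]
  rw [Finset.prod_pair (by simp), ExtCircuit.val_aux,
    L.net.val_of_fn (g := NetGate.fact r w) rfl]
  simp only [gatePred, netPred, Finset.sum_singleton]

end LayerData

/-! ## The simulation -/

namespace LabelledGraph

variable (G : LabelledGraph)

open Classical in
/-- The encoding of a graph with the vertices and edges of `G` and feature values `h`, as a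
vector. -/
noncomputable def encodeVec (h : Fin G.numV → ℝ) : Fin (G.numV * G.numV + G.numV) → ℝ :=
  Fin.append (fun p => G.graph.adjMatrix ℝ (finProdFinEquiv.symm p).1 (finProdFinEquiv.symm p).2) h

open Classical in
theorem encodeVec_adjIdx (h : Fin G.numV → ℝ) (w u : Fin G.numV) :
    G.encodeVec h (adjIdx w u) = if G.graph.Adj w u then 1 else 0 := by
  simp only [encodeVec, adjIdx, Fin.append_left, Equiv.symm_apply_apply,
    SimpleGraph.adjMatrix_apply]

theorem encodeVec_featIdx (h : Fin G.numV → ℝ) (w : Fin G.numV) :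
    G.encodeVec h (featIdx w) = h w := by
  simp [encodeVec, featIdx]

theorem encode_eq_ofFn (h : Fin G.numV → ℝ) :
    ({ G with feature := h } : LabelledGraph).encode = List.ofFn (G.encodeVec h) := by
  classical
  rw [encodeVec, List.ofFn_fin_append, List.ofFn_mul, encode, List.flatMap_def]
  congr 2
  rw [List.ofFn_eq_map]
  refine List.map_congr_left fun u _ => ?_
  rw [List.ofFn_eq_map]
  refine List.map_congr_left fun v _ => ?_
  have : (⟨u * G.numV + v, by nlinarith [u.isLt, v.isLt]⟩ : Fin (G.numV * G.numV)) =
      finProdFinEquiv (u, v) := by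
    ext; simp [finProdFinEquiv]; ring
  simp only [this, Equiv.symm_apply_apply, SimpleGraph.adjMatrix_apply]

theorem encode_length : G.encode.length = G.numV * G.numV + G.numV := by
  rw [show G.encode = _ from G.encode_eq_ofFn G.feature, List.length_ofFn]

/-- There are no loops, so `w` itself is missing from its list of neighbours. Hence degrees can be
indexed by `Fin n`. -/
theorem length_nbrs_lt (w : Fin G.numV) : (G.nbrs w).length < G.numV := by
  classical
  have h := List.length_filter_lt_length_iff_exists (l := List.finRange G.numV)
    (p := fun u => decide (G.graph.Adj w u))
  rw [List.length_finRange] at h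
  exact h.2 ⟨w, by simp⟩

open Classical in
theorem card_lt_nbrs_get (w : Fin G.numV) (j : Fin (G.nbrs w).length) :
    (Finset.univ.filter fun v => v < (G.nbrs w).get j ∧ G.graph.Adj w v).card = j := by
  have := card_filter_lt_get_filter (fun v => decide (G.graph.Adj w v)) j
  simp only [decide_eq_true_eq] at this
  exact this

theorem adj_nbrs_get (w : Fin G.numV) (j : Fin (G.nbrs w).length) :
    G.graph.Adj w ((G.nbrs w).get j) := by
  have := List.mem_filter.1 ((G.nbrs w).get_mem j)
  simpa using this.2

theorem mem_nbrs {w u : Fin G.numV} : u ∈ G.nbrs w ↔ G.graph.Adj w u := by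
  simp [nbrs]

open Classical in
theorem length_nbrs (w : Fin G.numV) :
    (G.nbrs w).length = (Finset.univ.filter fun v => G.graph.Adj w v).card := by
  have h : (Finset.univ.filter fun v => G.graph.Adj w v) = (G.nbrs w).toFinset := by
    ext v; simp [mem_nbrs]
  rw [h, List.toFinset_card_of_nodup (l := G.nbrs w) ((List.nodup_finRange _).filter _)]

end LabelledGraph

namespace LayerData

variable {d : ℕ} {G : LabelledGraph} (L : LayerData G.numV d) (h : Fin G.numV → ℝ)
  (a : Fin d → ℝ)

open Classical in
theorem val_cnt_encodeVec (w : Fin G.numV) (u : Fin (G.numV + 1)) :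
    L.net.val (G.encodeVec h) a (.inner (.cnt w u)) =
      (Finset.univ.filter fun v : Fin G.numV => v.castSucc < u ∧ G.graph.Adj w v).card := by
  rw [val_cnt]
  simp only [G.encodeVec_adjIdx, Finset.sum_boole, Finset.filter_filter]

theorem val_cnt_last (w : Fin G.numV) :
    L.net.val (G.encodeVec h) a (.inner (.cnt w (Fin.last G.numV))) = (G.nbrs w).length := by
  rw [val_cnt_encodeVec, G.length_nbrs]
  norm_cast
  congr 1
  ext v
  simp [v.castSucc_lt_last]

/-- A neighbour `u` of `w` is the `j`-th one exactly if `j` neighbours precede it. Non-neighbours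
with the same count are removed by the adjacency factor. -/
theorem val_sel_encodeVec (w : Fin G.numV) (j : Fin (G.nbrs w).length) :
    L.net.val (G.encodeVec h) a (.inner (.sel w (j.castLE (G.length_nbrs_lt w).le))) =
      h ((G.nbrs w).get j) := by
  classical
  have hcnt : ∀ k : Fin (G.nbrs w).length,
      L.net.val (G.encodeVec h) a (.inner (.cnt w ((G.nbrs w).get k).castSucc)) =
        ((k.castLE (G.length_nbrs_lt w).le).castSucc : Fin (G.numV + 1)) := by
    intro k
    rw [val_cnt_encodeVec]
    simp only [Fin.castSucc_lt_castSucc_iff, G.card_lt_nbrs_get]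
    simp
  rw [val_sel, Finset.sum_eq_single ((G.nbrs w).get j)]
  · rw [L.val_ind _ _ _ _ _ _ (hcnt j), G.encodeVec_adjIdx, if_pos (G.adj_nbrs_get w j), if_pos rfl,
      G.encodeVec_featIdx, one_mul, one_mul]
  · intro u _ hu
    rw [G.encodeVec_adjIdx]
    split_ifs with hadj
    · obtain ⟨k, rfl⟩ := List.mem_iff_get.1 (G.mem_nbrs.2 hadj)
      rw [L.val_ind _ _ _ _ _ _ (hcnt k), if_neg]
      · simp
      · intro hk
        have : k = j := Fin.ext (by simpa using congrArg Fin.val hk)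
        exact hu (by rw [this])
    · simp
  · simp

theorem ofFn_source (w : Fin G.numV) :
    List.ofFn (fun j => L.net.val (G.encodeVec h) a
      (L.source w ⟨(G.nbrs w).length, G.length_nbrs_lt w⟩ j)) =
        h w :: (G.nbrs w).map h := by
  rw [List.ofFn_succ]
  congr 1
  · exact (L.net.val_inp _ _ _).trans (G.encodeVec_featIdx h w)
  · conv_rhs => rw [← List.ofFn_get (G.nbrs w), List.map_ofFn]
    exact congrArg List.ofFn (funext fun j => L.val_sel_encodeVec h a w j)

/-- The circuit computes one layer of the network on the encoding of a graph. -/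
theorem val_new_encodeVec {f : Fin d → List ℝ → ℝ}
    (hsub : ∀ r t y, (L.sub r t).eval y Fin.elim0 0 = f r (List.ofFn y)) (r : Fin d)
    (w : Fin G.numV) :
    L.net.val (G.encodeVec h) (fun s => if s = r then 1 else 0) (.inner (.new w)) =
      L.act r (f r (h w :: (G.nbrs w).map h)) := by
  rw [val_new, Finset.sum_eq_single r]
  · rw [if_pos rfl, one_mul,
      L.val_fval _ _ r w ⟨_, G.length_nbrs_lt w⟩ (L.val_cnt_last h _ w), hsub, ofFn_source]
  · intro s _ hs
    rw [if_neg hs, zero_mul]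
  · simp

end LayerData

/-! ### The recurrence: rotating layers and halting -/

/-- The cyclic predecessor of a layer. -/
def prevLayer {d : ℕ} (r : Fin d) : Fin d := ⟨(r + (d - 1)) % d, Nat.mod_lt _ r.pos⟩

theorem prevLayer_eq_iff {d : ℕ} (hd : 0 < d) (k : ℕ) (r : Fin d) :
    prevLayer r = ⟨k % d, Nat.mod_lt _ hd⟩ ↔ r = ⟨(k + 1) % d, Nat.mod_lt _ hd⟩ := by
  have h1 : (r : ℕ) % d = r := Nat.mod_eq_of_lt r.isLt
  simp only [prevLayer, Fin.ext_iff]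
  constructor
  · intro h
    have h2 : r + (d - 1) + 1 ≡ k + 1 [MOD d] := Nat.ModEq.add_right 1 h
    rw [add_assoc, Nat.sub_add_cancel hd] at h2
    rw [← h2, Nat.add_mod_right, h1]
  · intro h
    have h2 : (r : ℕ) ≡ k + 1 [MOD d] := by rw [Nat.ModEq, h1, h]
    have h3 := h2.add_right (d - 1)
    rw [add_assoc k, Nat.add_sub_cancel' hd] at h3
    rw [h3, Nat.add_mod_right]

namespace LayerData

variable {n d : ℕ}

/-- The recurrent circuit that simulates the network. -/
noncomputable abbrev recNet (L : LayerData n d) (halt : ℕ+ → List ℝ → Bool) :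
    RecCircuit (n * n + n) where
  numAux := d
  numOut := n * n + n
  circuit := L.net
  init r := if (r : ℕ) = 0 then 1 else 0
  recInp := L.next
  recAux r := .aux (prevLayer r)
  recInp_ne_out := L.next_ne_out
  recAux_ne_out := by simp
  numHalt := n
  haltGate := ⟨fun w => .inner (.new w), fun _ _ h => by simpa using h⟩
  halt k v := halt k (List.ofFn v)

variable {N : RecCGNN} {G : LabelledGraph} (L : LayerData G.numV d)

theorem val_next (h h' : Fin G.numV → ℝ) (a : Fin d → ℝ)
    (hnew : ∀ w, L.net.val (G.encodeVec h) a (.inner (.new w)) = h' w) (j) :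
    L.net.val (G.encodeVec h) a (L.next j) = G.encodeVec h' j := by
  cases j using Fin.addCases with
  | left p =>
    simp only [next, Fin.addCases_left]
    rw [ExtCircuit.val_inp]
    simp only [LabelledGraph.encodeVec, Fin.append_left]
  | right w =>
    simp only [next, Fin.addCases_right]
    rw [hnew]
    simp only [LabelledGraph.encodeVec, Fin.append_right]

/-- The circuits in `L` compute the layer functions of the periodic network `N`. -/
structure Realizes (L : LayerData n d) (N : RecCGNN) : Prop where
  pos : 0 < d
  periodic : Function.Periodic (fun k => (N.fn k, N.act k)) d
  sub_eval : ∀ r t y, (L.sub r t).eval y Fin.elim0 0 = N.fn (r + 1) (List.ofFn y)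
  act_eq : ∀ r, L.act r = N.act (r + 1)

variable {L}

theorem Realizes.val_new (hL : L.Realizes N) (k : ℕ) (w : Fin G.numV) :
    L.net.val (G.encodeVec (N.feat G k))
      (fun r => if r = ⟨k % d, Nat.mod_lt _ hL.pos⟩ then 1 else 0) (.inner (.new w)) =
        N.feat G (k + 1) w := by
  -- Layers are numbered from `1` and circuit indices from `0`: index `k % d` stands for layer `k +
  -- 1`.
  have hper : Function.Periodic (fun k => (N.fn (k + 1), N.act (k + 1))) d := fun k => by
    have := hL.periodic (k + 1)
    rwa [add_right_comm] at this
  have hk := hper.map_mod_nat k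
  simp only [Prod.mk.injEq] at hk
  rw [L.val_new_encodeVec _ hL.sub_eval, hL.act_eq]
  simp only [hk]
  rfl

/-- The loop invariant: iteration `k + 1` starts from the features after layer `k`, with the
selector at `k % d`, and so computes layer `k + 1`. -/
theorem Realizes.state_eq (hL : L.Realizes N) (k : ℕ) :
    (L.recNet N.halt).state (G.encodeVec G.feature) k =
      (G.encodeVec (N.feat G k), fun r => if r = ⟨k % d, Nat.mod_lt _ hL.pos⟩ then 1 else 0) := by
  induction k with
  | zero =>
    refine Prod.ext rfl (funext fun r => ?_)
    simp [RecCircuit.state, Fin.ext_iff]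
  | succ k ih =>
    rw [RecCircuit.state, Function.iterate_succ_apply', ← RecCircuit.state, ih]
    refine Prod.ext (funext fun j => ?_) (funext fun r => ?_)
    · exact L.val_next _ _ _ (hL.val_new k) j
    · refine (L.net.val_aux _ _ _).trans ?_
      exact if_congr (prevLayer_eq_iff hL.pos k r) rfl rfl

/-- The halting gates read the new features, not the stored ones, so the iteration number and the
layer number agree. -/
theorem Realizes.haltsAt_iff (hL : L.Realizes N) (k : ℕ) :
    (L.recNet N.halt).HaltsAt (G.encodeVec G.feature) k ↔ N.HaltsAt G k := by
  rw [RecCircuit.HaltsAt, hL.state_eq, RecCGNN.HaltsAt]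
  have : (fun w => L.net.val (G.encodeVec (N.feat G k))
      (fun r => if r = ⟨k % d, Nat.mod_lt _ hL.pos⟩ then 1 else 0) (.inner (.new w))) =
        N.feat G (k + 1) := funext (hL.val_new k)
  rw [← this]
  rfl

/-- The recurrent circuit computes the function of the network. -/
theorem Realizes.recNet_eval (hL : L.Realizes N) :
    ((L.recNet N.halt).eval (G.encodeVec G.feature)).map List.ofFn =
      (N.eval G).map LabelledGraph.encode := by
  classical
  refine Part.ext' (exists_congr hL.haltsAt_iff)
    fun (h1 : ∃ k, (L.recNet N.halt).HaltsAt (G.encodeVec G.feature) k)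
      (h2 : ∃ k, N.HaltsAt G k) => ?_
  have hf : Nat.find h1 = Nat.find h2 := Nat.find_congr' (hL.haltsAt_iff _)
  change List.ofFn (L.net.eval
      ((L.recNet N.halt).state (G.encodeVec G.feature) (Nat.find h1)).1
      ((L.recNet N.halt).state (G.encodeVec G.feature) (Nat.find h1)).2) =
    LabelledGraph.encode { G with feature := N.feat G (Nat.find h2 + 1) }
  rw [hL.state_eq, G.encode_eq_ofFn, hf]
  congr 1
  funext j
  rw [ExtCircuit.eval, ExtCircuit.val_out]
  simp only [gatePred, Finset.sum_singleton]
  exact L.val_next _ _ _ (hL.val_new _) j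

end LayerData

/-! ## Bounds -/

/-- The finitely many exceptional lengths are absorbed into the constant. A bound for all lengths is
needed since the circuit for `n` vertices contains layer circuits with every smaller number of
inputs. -/
theorem PolyBounded.exists_forall_le {s : ℕ → ℕ} (hs : PolyBounded s) :
    ∃ c k : ℕ, ∀ n, s n ≤ c * (n + 1) ^ k := by
  obtain ⟨k, hk⟩ := hs
  obtain ⟨C, hC⟩ := hk.bound
  obtain ⟨n₀, hn₀⟩ := eventually_atTop.1 hC
  refine ⟨⌈C⌉₊ + ∑ m ∈ Finset.range n₀, s m, k, fun n => ?_⟩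
  have hpos : 1 ≤ (n + 1) ^ k := Nat.one_le_pow _ _ n.succ_pos
  by_cases hn : n₀ ≤ n
  · have h1 := hn₀ n hn
    rw [Real.norm_of_nonneg (by positivity), Real.norm_of_nonneg (by positivity)] at h1
    have h2 : (s n : ℝ) ≤ (⌈C⌉₊ * (n + 1) ^ k : ℕ) := by
      push_cast
      refine h1.trans (mul_le_mul (Nat.le_ceil C) ?_ (by positivity) (by positivity))
      gcongr
      linarith
    exact (Nat.cast_le.1 h2).trans (Nat.mul_le_mul_right _ (Nat.le_add_right _ _))
  · have h1 : s n ≤ ∑ m ∈ Finset.range n₀, s m :=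
      Finset.single_le_sum (fun m _ => Nat.zero_le _) (Finset.mem_range.2 (not_le.1 hn))
    nlinarith [Nat.zero_le ⌈C⌉₊]

theorem PolyBounded.of_forall_le {s : ℕ → ℕ} {c k : ℕ} (hs : ∀ n, s n ≤ c * (n + 1) ^ k) :
    PolyBounded s := by
  refine ⟨k, IsBigO.of_bound (c * 2 ^ k) (eventually_atTop.2 ⟨1, fun n hn => ?_⟩)⟩
  rw [Real.norm_of_nonneg (by positivity), Real.norm_of_nonneg (by positivity), mul_assoc,
    ← mul_pow]
  refine (Nat.cast_le.2 (hs n)).trans ?_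
  push_cast
  have : (1 : ℝ) ≤ n := by exact_mod_cast hn
  gcongr
  linarith

/-- The summand `1` is needed because `Real.log` vanishes at `0` and `1`. -/
theorem PolylogBounded.exists_forall_le {i : ℕ} {s : ℕ → ℕ} (hs : PolylogBounded i s) :
    ∃ c : ℕ, ∀ n, (s n : ℝ) ≤ c * (1 + Real.log n ^ i) := by
  obtain ⟨C, hC⟩ := IsBigO.bound hs
  obtain ⟨n₀, hn₀⟩ := eventually_atTop.1 hC
  refine ⟨⌈C⌉₊ + ∑ m ∈ Finset.range n₀, s m, fun n => ?_⟩
  have hpos : 0 ≤ Real.log n ^ i := pow_nonneg (Real.log_natCast_nonneg n) i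
  have hS : (0 : ℝ) ≤ (∑ m ∈ Finset.range n₀, s m : ℕ) := Nat.cast_nonneg _
  have hC0 : (0 : ℝ) ≤ ⌈C⌉₊ := Nat.cast_nonneg _
  rw [Nat.cast_add]
  by_cases hn : n₀ ≤ n
  · have h1 := hn₀ n hn
    rw [Real.norm_of_nonneg (by positivity), Real.norm_of_nonneg hpos] at h1
    have h2 := mul_le_mul_of_nonneg_right (Nat.le_ceil C) hpos
    nlinarith [mul_nonneg hS hpos]
  · have h1 : s n ≤ ∑ m ∈ Finset.range n₀, s m :=
      Finset.single_le_sum (fun m _ => Nat.zero_le _) (Finset.mem_range.2 (not_le.1 hn))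
    have h2 : (s n : ℝ) ≤ (∑ m ∈ Finset.range n₀, s m : ℕ) := Nat.cast_le.2 h1
    nlinarith [mul_nonneg hS hpos, mul_nonneg hC0 hpos]

theorem PolylogBounded.of_forall_le {i : ℕ} {s : ℕ → ℕ} {c : ℕ}
    (hs : ∀ n, (s n : ℝ) ≤ c * (1 + Real.log n ^ i)) : PolylogBounded i s := by
  have hlog : ∀ᶠ n : ℕ in atTop, 1 ≤ Real.log n :=
    (Real.tendsto_log_atTop.comp tendsto_natCast_atTop_atTop).eventually_ge_atTop 1
  refine IsBigO.of_bound (c * 2) (hlog.mono fun n hn => ?_)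
  have h1 : 1 ≤ Real.log n ^ i := one_le_pow₀ hn
  rw [Real.norm_of_nonneg (by positivity), Real.norm_of_nonneg (by positivity), mul_assoc]
  refine (hs n).trans (mul_le_mul_of_nonneg_left ?_ (by positivity))
  linarith

theorem log_pow_le_log_pow {m n : ℕ} (h : m ≤ n) (i : ℕ) :
    Real.log m ^ i ≤ Real.log n ^ i := by
  refine pow_le_pow_left₀ (Real.log_natCast_nonneg m) ?_ i
  obtain rfl | hm := m.eq_zero_or_pos
  · simpa using Real.log_natCast_nonneg n
  · exact Real.log_le_log (Nat.cast_pos.2 hm) (Nat.cast_le.2 h)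

/-! ## Circuit families -/

theorem CircuitFamily.eval_ofFn (C : CircuitFamily) {n : ℕ} (y : Fin n → ℝ) :
    C.eval (List.ofFn y) = List.ofFn ((C.circuit n).eval y Fin.elim0) := by
  have h : ∀ (l : List ℝ) (hl : l.length = n), C.eval l =
      List.ofFn ((C.circuit n).eval (fun j => l.get (j.cast hl.symm)) Fin.elim0) := by
    intro l hl
    subst hl
    rfl
  rw [h _ (List.length_ofFn)]
  congr 2
  funext j
  simp

theorem RecCircuitFamily.eval_of_length (R : RecCircuitFamily) {n : ℕ} (l : List ℝ)
    (hl : l.length = n) :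
    R.eval l = ((R n).eval fun j => l.get (j.cast hl.symm)).map List.ofFn := by
  subst hl
  rfl

/-- Functions in `tFAC` are computed by circuits in which all paths are short. -/
theorem exists_circuit_of_mem_tFAC {i : ℕ} {B : Set (ℝ → ℝ)} {f : List ℝ → ℝ}
    (hf : f ∈ tFAC i B) : ∃ c k : ℕ, ∀ t : ℕ, ∃ C : ArithCircuit t 1,
      C.UsesOnly B ∧ C.size ≤ c * (t + 1) ^ k ∧
      (∀ y, C.eval y Fin.elim0 0 = f (List.ofFn y)) ∧
      ∃ rk : C.Gates → ℕ, (∀ g h, C.Edge g h → rk g < rk h) ∧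
        ∀ g, (rk g : ℝ) ≤ c * (1 + Real.log t ^ i) := by
  obtain ⟨-, F, ⟨hB, hs, hd⟩, hF⟩ := hf
  obtain ⟨c₁, k, h₁⟩ := hs.exists_forall_le
  obtain ⟨c₂, h₂⟩ := hd.exists_forall_le
  refine ⟨c₁ + c₂ + 2, k, fun t => ?_⟩
  have hpos : 0 ≤ Real.log t ^ i := pow_nonneg (Real.log_natCast_nonneg t) i
  have hev : ∀ y : Fin t → ℝ, List.ofFn ((F.circuit t).eval y Fin.elim0) = [f (List.ofFn y)] :=
    fun y => by rw [← F.eval_ofFn, hF]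
  have hout : F.numOut t = 1 := by simpa using congrArg List.length (hev 0)
  have hB := hB t
  have h₁ := h₁ t
  have h₂ := h₂ t
  -- The number of outputs occurs in the type of the circuit; both are generalized so that it can be
  -- replaced by `1`.
  generalize F.circuit t = C at *
  generalize F.numOut t = m at *
  subst hout
  obtain ⟨C', hB', hs', he', rk, hrk, hle⟩ := C.exists_ranked hB
  refine ⟨C', hB', ?_, fun y => ?_, rk, hrk, fun g => ?_⟩
  · rw [hs']
    exact h₁.trans (Nat.mul_le_mul_right _ (by omega))
  · rw [he']
    simpa using hev y
  · have h3 : (rk g : ℝ) ≤ C.ioDepth + 2 := by exact_mod_cast hle g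
    have h4 : (0 : ℝ) ≤ c₁ := Nat.cast_nonneg _
    push_cast
    nlinarith [mul_nonneg h4 hpos]

/-- The layers of a periodic network are realized by circuits of polynomial size and
polylogarithmic depth. -/
theorem RecCGNN.IsGNN.exists_layerData {N : RecCGNN} {H : Set (ℕ+ → List ℝ → Bool)} {i : ℕ}
    {B A : Set (ℝ → ℝ)} (hN : N.IsGNN H (tFAC i B) A) :
    ∃ d c k : ℕ, ∀ n, ∃ L : LayerData n d, L.Realizes N ∧
      (∀ r t, (L.sub r t).UsesOnly B) ∧ (∀ r, L.act r ∈ A) ∧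
      L.maxSize ≤ c * (n + 1) ^ k ∧ (L.bound : ℝ) ≤ c * (1 + Real.log n ^ i) := by
  obtain ⟨d, hd, hper⟩ := hN.periodic
  choose c k C hB hs he rk hrk hle using
    fun r : Fin d => exists_circuit_of_mem_tFAC (hN.fn_mem (r + 1))
  have hc : ∀ r, c r ≤ Finset.univ.sup c := fun r => Finset.le_sup (Finset.mem_univ r)
  have hk : ∀ r, k r ≤ Finset.univ.sup k := fun r => Finset.le_sup (Finset.mem_univ r)
  refine ⟨d, Finset.univ.sup c, Finset.univ.sup k, fun n => ?_⟩
  have hpos : 0 ≤ Real.log n ^ i := pow_nonneg (Real.log_natCast_nonneg n) i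
  refine ⟨{
    sub := fun r t => C r (t + 1)
    act := fun r => N.act (r + 1)
    rk := fun r t => rk r (t + 1)
    bound := ⌊(Finset.univ.sup c : ℕ) * (1 + Real.log n ^ i)⌋₊
    rk_lt := fun r t => hrk r (t + 1)
    rk_le := fun r t g => Nat.le_floor ((hle r (t + 1) g).trans ?_)
    maxSize := Finset.univ.sup c * (n + 1) ^ Finset.univ.sup k
    size_le := fun r t => (hs r (t + 1)).trans ?_ },
    ⟨hd, hper, fun r t => he r (t + 1), fun r => rfl⟩, fun r t => hB r (t + 1),
    fun r => hN.act_mem _, le_rfl, Nat.floor_le (by positivity)⟩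
  -- Degree `t < n` uses a circuit with `t + 1 ≤ n` inputs, so its bounds pass to `n` by
  -- monotonicity.
  · have h1 := log_pow_le_log_pow (Nat.succ_le_of_lt t.isLt) i
    have h2 : (c r : ℝ) ≤ (Finset.univ.sup c : ℕ) := Nat.cast_le.2 (hc r)
    have h3 : 0 ≤ Real.log (t + 1 : ℕ) ^ i := pow_nonneg (Real.log_natCast_nonneg _) i
    gcongr
  · have h1 := t.isLt
    refine Nat.mul_le_mul (hc r) ((Nat.pow_le_pow_right (Nat.succ_pos _) (hk r)).trans ?_)
    exact Nat.pow_le_pow_left (by omega) _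

/-! ### Assembling the family over all input lengths -/

/-- A recurrent circuit without inner gates. -/
def RecCircuit.trivial (M : ℕ) (halt : ℕ+ → List ℝ → Bool) : RecCircuit M where
  numAux := 0
  numOut := 0
  circuit :=
    { Inner := Empty
      fintypeInner := inferInstance
      op := Empty.elim
      pred := fun _ => ∅
      acyclic := fun g hg => by
        obtain ⟨_, _, h⟩ := Relation.TransGen.tail'_iff.1 hg
        simp at h
      pred_inp := fun _ => rfl
      pred_aux := fun _ => rfl
      pred_out := fun j => j.elim0
      out_notMem_pred := fun j => j.elim0
      pred_const := fun g => g.elim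
      pred_fn := fun g => g.elim
      succ_fn := fun g => g.elim }
  init := Fin.elim0
  recInp := .inp
  recAux := Fin.elim0
  recInp_ne_out := by simp
  recAux_ne_out := fun j => j.elim0
  numHalt := 0
  haltGate := ⟨Fin.elim0, fun j => j.elim0⟩
  -- The network's halting function is kept here too, so that one circuit family serves all input
  -- lengths.
  halt k v := halt k (List.ofFn v)

/-- For every input length there is a small recurrent circuit that simulates the network on all
graphs whose encodings have this length. -/
theorem RecCGNN.IsGNN.exists_recCircuit {N : RecCGNN} {H : Set (ℕ+ → List ℝ → Bool)} {i : ℕ}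
    {B A : Set (ℝ → ℝ)} (hN : N.IsGNN H (tFAC i B) A) :
    ∃ c k : ℕ, ∀ M, ∃ R : RecCircuit M, R.circuit.UsesOnly (B ∪ A) ∧
      R.circuit.size ≤ c * (M + 1) ^ k ∧
      (R.circuit.depth : ℝ) ≤ c * (1 + Real.log M ^ i) ∧
      (∀ m v, R.halt m v = N.halt m (List.ofFn v)) ∧
      ∀ (G : LabelledGraph) (hG : G.encode.length = M),
        (R.eval fun j => G.encode.get (j.cast hG.symm)).map List.ofFn =
          (N.eval G).map LabelledGraph.encode := by
  obtain ⟨d, c, k, hL⟩ := hN.exists_layerData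
  -- One constant for both bounds: `2` for inputs and outputs, `d` for auxiliary gates, the product
  -- for inner gates, `c + 12` for the depth. The exponent combines `(n + 1) ^ 3` index triples with
  -- copies of size about `(n + 1) ^ k`.
  refine ⟨2 + d + 13 * ((d + 1) * (c + 1)) + (c + 12), k + 3, fun M => ?_⟩
  have hX : ∀ e, 1 ≤ (M + 1) ^ e := fun e => Nat.one_le_pow _ _ M.succ_pos
  have hM : M + 1 ≤ (M + 1) ^ (k + 3) := Nat.le_self_pow (by omega) _
  by_cases h : ∃ n, n * n + n = M
  · obtain ⟨n, hn⟩ := h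
    obtain ⟨L, hr, hB, hA, hs, hb⟩ := hL n
    have hnM : n ≤ M := by rw [← hn]; exact Nat.le_add_left _ _
    have hsize : L.net.size ≤
        (2 + d + 13 * ((d + 1) * (c + 1)) + (c + 12)) * (M + 1) ^ (k + 3) := by
      refine L.net_size_le.trans ?_
      rw [hn]
      have h1 : (n + 1) ^ 3 ≤ (M + 1) ^ 3 := Nat.pow_le_pow_left (by omega) 3
      have h2 : L.maxSize + 1 ≤ (c + 1) * (M + 1) ^ k := by
        have h3 : (n + 1) ^ k ≤ (M + 1) ^ k := Nat.pow_le_pow_left (by omega) k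
        have h4 := Nat.mul_le_mul_left c h3
        have := hX k
        nlinarith
      have h3 : 13 * ((d + 1) * ((n + 1) ^ 3 * (L.maxSize + 1))) ≤
          13 * ((d + 1) * (c + 1)) * (M + 1) ^ (k + 3) := by
        calc _ ≤ 13 * ((d + 1) * ((M + 1) ^ 3 * ((c + 1) * (M + 1) ^ k))) := by gcongr
          _ = _ := by ring
      have h4 : d ≤ d * (M + 1) ^ (k + 3) := Nat.le_mul_of_pos_right _ (hX _)
      have h5 : 0 ≤ (c + 12) * (M + 1) ^ (k + 3) := Nat.zero_le _
      simp only [add_mul (_ + _), add_mul 2 d]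
      omega
    have hdepth : (L.net.depth : ℝ) ≤
        (2 + d + 13 * ((d + 1) * (c + 1)) + (c + 12) : ℕ) * (1 + Real.log M ^ i) := by
      have h1 : (L.net.depth : ℝ) ≤ L.bound + 12 := by exact_mod_cast L.net_depth_le
      have h2 := log_pow_le_log_pow hnM i
      have h3 : 0 ≤ Real.log n ^ i := pow_nonneg (Real.log_natCast_nonneg n) i
      calc (L.net.depth : ℝ) ≤ c * (1 + Real.log n ^ i) + 12 := by linarith
        _ ≤ (c + 12 : ℕ) * (1 + Real.log n ^ i) := by push_cast; nlinarith
        _ ≤ _ := mul_le_mul (Nat.cast_le.2 (Nat.le_add_left _ _)) (by linarith) (by positivity)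
          (by positivity)
    refine ⟨hn ▸ L.recNet N.halt, ?_⟩
    subst hn
    refine ⟨L.net_usesOnly hB hA, hsize, hdepth, fun _ _ => rfl, fun G hG => ?_⟩
    -- The map `n ↦ n * n + n` is strictly increasing, so the length of an encoding determines the
    -- number of vertices.
    have hGn : G.numV = n := by
      rw [G.encode_length] at hG
      nlinarith [lt_trichotomy G.numV n]
    subst hGn
    rw [← hr.recNet_eval]
    congr 2
    funext j
    have he : G.encode = List.ofFn (G.encodeVec G.feature) := G.encode_eq_ofFn G.feature
    simp [he]
  · refine ⟨RecCircuit.trivial M N.halt, fun g => g.elim, ?_, ?_, fun _ _ => rfl, fun G hG => ?_⟩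
    · have h0 : Fintype.card (RecCircuit.trivial M N.halt).circuit.Inner = 0 :=
        Fintype.card_eq_zero_iff.2 (inferInstanceAs (IsEmpty Empty))
      rw [ExtCircuit.size_eq, h0]
      exact M.le_succ.trans (hM.trans (Nat.le_mul_of_pos_left _ (by omega)))
    · have h1 : (RecCircuit.trivial M N.halt).circuit.depth ≤ 0 :=
        (RecCircuit.trivial M N.halt).circuit.depth_le (rk := fun _ => 0)
          (fun g _ e => absurd e (Finset.notMem_empty g)) fun _ => le_rfl
      have hpos : 0 ≤ Real.log M ^ i := pow_nonneg (Real.log_natCast_nonneg M) i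
      rw [Nat.le_zero.1 h1, Nat.cast_zero]
      positivity
    · exact absurd ⟨G.numV, G.encode_length.symm.trans hG⟩ h

theorem mainTheorem1 (i : ℕ) (B A : Set (ℝ → ℝ)) (N : RecCGNN)
    (hN : N.IsGNN (tFACHalt i (B ∪ {signFn})) (tFAC i B) A) :
    ∃ fcirc ∈ RecFAC i (B ∪ {signFn}) i (B ∪ A), ∀ G : LabelledGraph,
      fcirc G.encode = (N.eval G).map LabelledGraph.encode := by
  obtain ⟨c, k, hR⟩ := hN.exists_recCircuit
  choose R hB hs hd hh he using hR
  obtain ⟨-, D, hD, hDe⟩ := hN.halt_mem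
  refine ⟨RecCircuitFamily.eval R, ⟨R, ⟨hB, .of_forall_le hs, .of_forall_le hd⟩,
    ⟨D, hD, fun n m v => by rw [hDe, hh]⟩, rfl⟩, fun G => ?_⟩
  rw [RecCircuitFamily.eval_of_length R G.encode rfl, he _ G rfl]
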